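/- **Setting.** Let $S$ be a countably infinite set, and let $\mathcal E_S$ be the set of unordered pairs $\{x,y\}$ with $x\neq y$ in $S$. To each pair associate $c_{x,y}=c_{y,x}\in[0,\infty)$, and put $c_{x,x}:=0$. Assume that * (C1) $c_x:=\sum_{y\in S}c_{x,y}<\infty$ for all $x\in S$; * (C2) for every $x\in S$ the continuous-time random walk started at $x$ a.s. does not explode. This walk waits at each visited site $y$ an exponential time of mean $1/c_y$ (infinite if $c_y=0$) and then jumps to $z$ with probability $c_{y,z}/c_y$. Non-explosion means that the waiting times have infinite sum. Let $D_W$ denote the space of càdlàg paths $[0,\infty)\to W$ with the $\sigma$-algebra generated by the coordinate maps. Let $\mathbb P$ be the law on $D_{\mathbb N}^{\mathcal E_S}$ of a family $\mathcal K=(\mathcal K_{x,y})_{\{x,y\}\in\mathcal E_S}$ of independent Poisson processes, $\mathcal K_{x,y}$ having intensity $c_{x,y}$. Write $\mathcal K_x(t)=\sum_{y\ne x}\mathcal K_{x,y}(t)$. Let $\Gamma$ be the set of those $\mathcal K$ such that every $\mathcal K_x$ is finite and càdlàg with all jumps equal to $+1$, all jumps of every $\mathcal K_{x,y}$ equal $+1$,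 and distinct pairs have disjoint sets of jump times. For $\mathcal K\in\Gamma$, $x\in S$ and $t\ge0$, define $X^x_t[\mathcal K]\in S\cup\{\partial\}$ as follows. Start at $x$ and take the last jump time $t_1\le t$ of $\mathcal K_x$. Move to the unique $x_1$ such that $t_1$ is a jump time of $\mathcal K_{x,x_1}$. Then take the last jump time $t_2<t_1$ of $\mathcal K_{x_1}$, move along the corresponding pair, and so on, until there is no such jump time. $X^x_t[\mathcal K]$ is the last site reached, and it is $\partial$ if the procedure never stops. Let $\Gamma_*$ be the set of $\mathcal K\in\Gamma$ with $X_t^x[\mathcal K]\in S$ for all $x,t$. For $\mathcal K\in\Gamma_*$ and $\sigma\in\{0,1\}^S$ put $\eta^\sigma_t[\mathcal K](x):=\sigma(X^x_t[\mathcal K])$. The path $\eta^\sigma_\cdot[\mathcal K]$ is càdlàg in $\{0,1\}^S$ with the product topology. Finally let $\mathbb P^\sigma(A):=\mathbb P(\mathcal K\in\Gamma_*:\eta^\sigma_\cdot[\mathcal K]\in A)$ for measurable $A\subset D_{\{0,1\}^S}$. **Proposition (Feller property).** For every $f\in C(\{0,1\}^S)$ and every $t\ge0$ the function $$(S(t)f)(\sigma):=\mathbb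 E\big[f(\eta^\sigma_t[\mathcal K])\big]=\int d\mathbb P^\sigma(\eta_\cdot)\,f(\eta_t)$$ (the two expressions being equal, with $\mathbb E[\,\cdot\,]$ the integral over $\Gamma_*$ with respect to $\mathbb P$) is continuous on $\{0,1\}^S$. In particular, the symmetric simple exclusion process $(\mathbb P^\sigma)_{\sigma\in\{0,1\}^S}$ is a Feller process. That is, these maps are continuous and $(\mathbb P^\sigma)_\sigma$ is a Markov process: * each $\mathbb P^\sigma$ is a probability measure; * $\mathbb P^\sigma(\eta_0=\sigma)=1$; * $\sigma\mapsto\mathbb P^\sigma(A)$ is measurable for every measurable $A$; * $\mathbb P^\sigma(\eta_{t+\cdot}\in A\mid\mathcal F_t)=\mathbb P^{\eta_t}(A)$ $\mathbb P^\sigma$-a.s. for all measurable $A$ and $t\ge 0$, where $\mathcal F_t$ is generated by $(\eta_s)_{s\le t}$. Moreover the $S(t)$, $t\ge0$, are bounded linear operators on $C(\{0,1\}^S)$ with the uniform norm and form a strongly continuous semigroup: $S(0)=\mathrm{id}$, $S(s+t)=S(s)S(t)$, and $\|S(t)f-f\|_\infty\to0$ as $t\downarrow0$ for every $f$. -/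

import Mathlib

open MeasureTheory ProbabilityTheory Filter Topology
open scoped NNReal ENNReal

noncomputable section

namespace SSEP

/-! ### Càdlàg paths -/

/-- Right-continuous with left limits on `[0, ∞)` (at time `0` the left limit is no condition). -/
def IsCadlag {W : Type*} [TopologicalSpace W] (ζ : ℝ≥0 → W) : Prop :=
  (∀ t, ContinuousWithinAt ζ (Set.Ici t) t) ∧ ∀ t, ∃ l, Tendsto ζ (𝓝[<] t) (𝓝 l)

/-- The space `D(ℝ₊, W)` of càdlàg paths. As a subtype of `ℝ≥0 → W` it carries the `σ`-algebra
generated by the coordinate maps `ζ ↦ ζ t`; for separable metrizable `W` with its Borel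
`σ`-algebra this is the Borel `σ`-algebra of the Skorohod topology. -/
abbrev CadlagPath (W : Type*) [TopologicalSpace W] : Type _ := {ζ : ℝ≥0 → W // IsCadlag ζ}

/-- The set of jump times `{t : ζ(t-) ≠ ζ(t)}`. Time `0` is never a jump time. -/
def jumpTimes (ζ : ℝ≥0 → ℕ) : Set ℝ≥0 := {t | Function.leftLim ζ t ≠ ζ t}

/-- All jumps have value `+1`. -/
def UnitJumps (ζ : ℝ≥0 → ℕ) : Prop := ∀ t ∈ jumpTimes ζ, ζ t = Function.leftLim ζ t + 1

theorem isCadlag_shift {W : Type*} [TopologicalSpace W] {ζ : ℝ≥0 → W} (h : IsCadlag ζ) (t : ℝ≥0) :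
    IsCadlag fun s => ζ (t + s) := by
  have hc : Continuous fun s : ℝ≥0 => t + s := by fun_prop
  refine ⟨fun s => ?_, fun s => ?_⟩
  · refine ContinuousWithinAt.comp (h.1 (t + s)) hc.continuousWithinAt fun u hu => ?_
    exact add_le_add_right (Set.mem_Ici.1 hu) t
  · obtain ⟨l, hl⟩ := h.2 (t + s)
    refine ⟨l, hl.comp ?_⟩
    refine tendsto_nhdsWithin_iff.2
      ⟨hc.continuousWithinAt.tendsto, ?_⟩
    filter_upwards [self_mem_nhdsWithin] with u hu
    exact add_lt_add_right (Set.mem_Iio.1 hu) t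

/-- The shifted path `ζ(t + ·)`. -/
def shift {W : Type*} [TopologicalSpace W] (t : ℝ≥0) (ζ : CadlagPath W) : CadlagPath W :=
  ⟨fun s => ζ.1 (t + s), isCadlag_shift ζ.2 t⟩

/-- The canonical filtration `ℱ_t = σ(ζ(s) : s ≤ t)` on the càdlàg path space. -/
def canonicalFiltration (W : Type*) [TopologicalSpace W] [MeasurableSpace W] :
    Filtration ℝ≥0 (inferInstance : MeasurableSpace (CadlagPath W)) where
  seq t := ⨆ s : Set.Iic t, MeasurableSpace.comap (fun ζ : CadlagPath W => ζ.1 s) inferInstance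
  mono' _ _ hab := iSup_le fun s => le_iSup_of_le ⟨s.1, le_trans s.2 hab⟩ le_rfl
  le' _ := iSup_le fun s =>
    Measurable.comap_le ((measurable_pi_apply (s : ℝ≥0)).comp measurable_subtype_coe)

/-! ### Markov and Feller processes -/

/-- A family `(P^w)` of laws on the càdlàg path space, filtered by the canonical filtration,
is a (time-homogeneous) Markov process. -/
structure IsMarkovProcess {W : Type*} [TopologicalSpace W] [MeasurableSpace W]
    (P : W → Measure (CadlagPath W)) : Prop where
  isProbabilityMeasure : ∀ w, IsProbabilityMeasure (P w)
  start : ∀ w, ∀ᵐ ζ ∂P w, ζ.1 0 = w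
  measurable : ∀ A : Set (CadlagPath W), MeasurableSet A → Measurable fun w => P w A
  /-- `P^w (ζ(t + ·) ∈ A | ℱ_t) = P^{ζ(t)} (A)`, `P^w`-almost surely. -/
  markov : ∀ (w : W) (t : ℝ≥0) (A : Set (CadlagPath W)), MeasurableSet A →
    (P w)⟦shift t ⁻¹' A | canonicalFiltration W t⟧ =ᵐ[P w] fun ζ => (P (ζ.1 t)).real A

/-- A Feller process on a (compact) state space: a Markov process whose transition operators
map continuous functions to continuous functions. -/
structure IsFellerProcess {W : Type*} [TopologicalSpace W] [MeasurableSpace W]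
    (P : W → Measure (CadlagPath W)) : Prop extends IsMarkovProcess P where
  feller : ∀ (f : C(W, ℝ)) (t : ℝ≥0), Continuous fun w => ∫ ζ, f (ζ.1 t) ∂P w

/-- A strongly continuous semigroup of bounded operators on a normed space. -/
structure IsStronglyContinuousSemigroup {E : Type*} [NormedAddCommGroup E] [NormedSpace ℝ E]
    (T : ℝ≥0 → E →L[ℝ] E) : Prop where
  zero : T 0 = ContinuousLinearMap.id ℝ E
  add : ∀ s t, T (s + t) = (T s).comp (T t)
  strong : ∀ f, Tendsto (fun t => T t f) (𝓝[>] 0) (𝓝 f)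

/-! ### Conductances and the random walk -/

section Graph

variable {S : Type*}

/-- The unordered pairs `{x, y}` of distinct elements of `S`. -/
abbrev Edge (S : Type*) : Type _ := {e : Sym2 S // ¬ e.IsDiag}

/-- The pair `{x, y}`. -/
def edge {x y : S} (h : x ≠ y) : Edge S := ⟨s(x, y), by simpa using h⟩

open Classical in
/-- The symmetric rate `c_{x,y}`, with the convention `c_{x,x} = 0`. -/
def rate (c : Edge S → ℝ≥0) (x y : S) : ℝ≥0 := if h : x ≠ y then c (edge h) else 0

/-- The total rate `c_x = ∑_y c_{x,y}`, as an element of `[0, ∞]`. -/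
def exitRate (c : Edge S → ℝ≥0) (x : S) : ℝ≥0∞ := ∑' y, (rate c x y : ℝ≥0∞)

open Classical in
/-- The law of the site to which the walk jumps from `x`: it is `y` with probability
`c_{x,y} / c_x`. If `c_x = 0` the walk never leaves `x`, and the jump law is irrelevant
(the value for `c_x = ∞` is irrelevant too, this being excluded where the walk is used). -/
def jumpLaw (c : Edge S → ℝ≥0) (x : S) : PMF S :=
  if h : exitRate c x ≠ 0 ∧ exitRate c x ≠ ∞ then
    PMF.normalize (fun y => (rate c x y : ℝ≥0∞)) h.1 h.2
  else PMF.pure x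

variable [Countable S] [MeasurableSpace S] [DiscreteMeasurableSpace S]

/-- The transition kernel of the sequence of visited sites. -/
def jumpKernel (c : Edge S → ℝ≥0) : Kernel S S :=
  Kernel.ofFunOfCountable fun x => (jumpLaw c x).toMeasure

instance (c : Edge S → ℝ≥0) : IsMarkovKernel (jumpKernel c) :=
  ⟨fun x => inferInstanceAs (IsProbabilityMeasure (jumpLaw c x).toMeasure)⟩

/-- The law of the sequence `(Y_0, Y_1, …)` of sites visited by the walk started at `x`:
the Markov chain with `Y_0 = x` and transition kernel `jumpKernel c`. -/
def jumpChain (c : Edge S → ℝ≥0) (x : S) : Measure (ℕ → S) :=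
  Kernel.traj (X := fun _ => S)
    (fun n => (jumpKernel c).comap
      (fun h : (i : Finset.Iic n) → S => h ⟨n, Finset.mem_Iic.2 le_rfl⟩)
      (measurable_pi_apply _)) 0 (fun _ => x)

/-- The law of the walk started at `x`: the visited sites `Y_n`, together with independent
standard exponential variables `ξ_n`. The walk stays at `Y_n` for the time `ξ_n / c_{Y_n}`, which
is exponential of mean `1 / c_{Y_n}`, and infinite if `c_{Y_n} = 0`. -/
def walkLaw (c : Edge S → ℝ≥0) (x : S) : Measure ((ℕ → S) × (ℕ → ℝ)) :=
  (jumpChain c x).prod (Measure.infinitePi fun _ : ℕ => expMeasure 1)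

/-- The walk started at `x` almost surely has no explosion: the waiting times have infinite sum. -/
def NoExplosion (c : Edge S → ℝ≥0) (x : S) : Prop :=
  ∀ᵐ w ∂walkLaw c x, ∑' n, ENNReal.ofReal (w.2 n) / exitRate c (w.1 n) = ∞

/-- The random walk with conductances `c` is well defined for all times. -/
structure WalkWellDefined (c : Edge S → ℝ≥0) : Prop where
  exitRate_ne_top : ∀ x, exitRate c x ≠ ∞
  noExplosion : ∀ x, NoExplosion c x

end Graph

/-! ### The Poisson clocks -/

/-- Poisson process of intensity `r` on `[0, ∞)`. As `N` is almost surely nondecreasing, the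
truncated difference `N t - N s` is almost surely the increment. -/
structure IsPoissonProcess {Ω : Type*} [MeasurableSpace Ω] (μ : Measure Ω) (N : ℝ≥0 → Ω → ℕ)
    (r : ℝ≥0) : Prop where
  zero : ∀ᵐ ω ∂μ, N 0 ω = 0
  mono : ∀ᵐ ω ∂μ, Monotone fun t => N t ω
  indep : HasIndepIncrements N μ
  law : ∀ s t, s ≤ t → HasLaw (fun ω => N t ω - N s ω) (poissonMeasure (r * (t - s))) μ

/-- The space `D(ℝ₊, ℕ)^{ℰ_S}` of families `𝒦 = (𝒦_{x,y})` of paths. -/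
abbrev Clocks (S : Type*) : Type _ := Edge S → CadlagPath ℕ

/-- `Pr` is the law of a family of independent Poisson processes, that of the pair `e` having
intensity `c e`. -/
structure IsPoissonClockLaw {S : Type*} (c : Edge S → ℝ≥0) (Pr : Measure (Clocks S)) : Prop where
  isProbabilityMeasure : IsProbabilityMeasure Pr
  indep : iIndepFun (fun (e : Edge S) (K : Clocks S) => K e) Pr
  poisson : ∀ e, IsPoissonProcess Pr (fun t K => (K e).1 t) (c e)

/-! ### The stirring construction -/

section Stirring

variable {S : Type*}

/-- `𝒦_x(t) = ∑_{y ≠ x} 𝒦_{x,y}(t)`, used only where this sum is finite. -/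
def siteClock (K : Clocks S) (x : S) (t : ℝ≥0) : ℕ := ∑' y : {y // x ≠ y}, (K (edge y.2)).1 t

/-- The set `Γ`. Summability in `ℕ` (discrete topology) says that the sum is finite. -/
structure InGamma (K : Clocks S) : Prop where
  finite : ∀ x t, Summable fun y : {y // x ≠ y} => (K (edge y.2)).1 t
  isCadlag : ∀ x, IsCadlag (siteClock K x)
  unitJumps_site : ∀ x, UnitJumps (siteClock K x)
  unitJumps : ∀ e, UnitJumps (K e).1
  disjoint : ∀ e e', e ≠ e' → Disjoint (jumpTimes (K e).1) (jumpTimes (K e').1)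

/-- `Explore K x U z`: the backward exploration that is at the site `x` and looks at the jump times
in `U` terminates, with output `z`. If `𝒦_x` has no jump time in `U`, it stops and outputs `x`;
otherwise it takes the last jump time `u` of `𝒦_x` in `U`, moves to the site `y` such that `u` is a
jump time of `𝒦_{x,y}`, and looks from there at the jump times in `[0, u)`. -/
inductive Explore (K : Clocks S) : S → Set ℝ≥0 → S → Prop
  | halt {x : S} {U : Set ℝ≥0} (h : jumpTimes (siteClock K x) ∩ U = ∅) : Explore K x U x
  | move {x y z : S} {U : Set ℝ≥0} {u : ℝ≥0} (hu : IsGreatest (jumpTimes (siteClock K x) ∩ U) u)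
      (hxy : x ≠ y) (hy : u ∈ jumpTimes (K (edge hxy)).1) (h : Explore K y (Set.Iio u) z) :
      Explore K x U z

open Classical in
/-- `X_t^x[𝒦]`, the output of the exploration from `x` of the jump times in `[0, t]`, or `none`
(standing for the extra state `∂`) if the exploration does not stop. For `𝒦 ∈ Γ` the output is
unique. -/
def stir (K : Clocks S) (t : ℝ≥0) (x : S) : Option S :=
  if h : ∃ z, Explore K x (Set.Iic t) z then some h.choose else none

/-- The set `Γ_*` of the `𝒦 ∈ Γ` with `X_t^x[𝒦] ∈ S` for all `x` and `t`. -/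
def gammaStar (S : Type*) : Set (Clocks S) := {K | InGamma K ∧ ∀ t x, stir K t x ≠ none}

/-- `η_t^σ[𝒦](x) = σ(X_t^x[𝒦])` (used for `𝒦 ∈ Γ_*`). Configurations in `{0,1}^S` are functions
`S → Bool`, with the product topology and the product `σ`-algebra. -/
def config (σ : S → Bool) (K : Clocks S) (t : ℝ≥0) : S → Bool :=
  fun x => (stir K t x).elim false σ

theorem leftLim_eq_of_const {g : ℝ≥0 → ℕ} {a b s : ℝ≥0} {n : ℕ} (has : a < s) (hsb : s < b)
    (h : ∀ u ∈ Set.Ioo a b, g u = n) : Function.leftLim g s = g s := by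
  have hne : 𝓝[<] s ≠ ⊥ := (mem_closure_iff_nhdsWithin_neBot.1
    (by rw [closure_Iio' ⟨a, has⟩]; exact Set.mem_Iic.2 le_rfl)).ne
  have hev : Tendsto g (𝓝[<] s) (𝓝 (g s)) := by
    rw [h s ⟨has, hsb⟩]
    refine tendsto_const_nhds.congr' ?_
    filter_upwards [Ioo_mem_nhdsLT has] with u hu
    exact (h u ⟨hu.1, hu.2.trans hsb⟩).symm
  have : (𝓝[<] s).NeBot := ⟨hne⟩
  exact leftLim_eq_of_tendsto hev

theorem stir_eq_of_no_jump {K : Clocks S} {x : S} {s t : ℝ≥0} (hst : s ≤ t)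
    (h : ∀ u, s < u → u ≤ t → u ∉ jumpTimes (siteClock K x)) : stir K s x = stir K t x := by
  have hJ : jumpTimes (siteClock K x) ∩ Set.Iic s = jumpTimes (siteClock K x) ∩ Set.Iic t := by
    ext u
    refine ⟨fun hu => ⟨hu.1, le_trans hu.2 hst⟩, fun hu => ⟨hu.1, ?_⟩⟩
    by_contra hlt
    exact h u (not_le.1 hlt) hu.2 hu.1
  have key : ∀ {U V : Set ℝ≥0}, jumpTimes (siteClock K x) ∩ U = jumpTimes (siteClock K x) ∩ V →
      ∀ z, Explore K x U z → Explore K x V z := by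
    intro U V hUV z hz
    cases hz with
    | halt h => exact .halt (hUV ▸ h)
    | move hu hxy hy h => exact .move (hUV ▸ hu) hxy hy h
  have hE : Explore K x (Set.Iic s) = Explore K x (Set.Iic t) :=
    funext fun z => propext ⟨key hJ z, key hJ.symm z⟩
  have hgen : ∀ p q : S → Prop, p = q →
      (open Classical in if h : ∃ z, p z then some h.choose else none) =
      (open Classical in if h : ∃ z, q z then some h.choose else none) := by
    rintro p _ rfl; rfl
  exact hgen _ _ hE

theorem isCadlag_config (σ : S → Bool) {K : Clocks S} (hK : InGamma K) :
    IsCadlag (config σ K) := by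
  refine ⟨fun t => ?_, fun t => ?_⟩
  · refine continuousWithinAt_pi.2 fun x => ?_
    have h1 : ∀ᶠ s in 𝓝[≥] t, siteClock K x s = siteClock K x t := by
      have := (hK.isCadlag x).1 t
      rw [ContinuousWithinAt, nhds_discrete, tendsto_pure] at this
      exact this
    obtain ⟨b, hb, hsub⟩ := (mem_nhdsGE_iff_exists_Ico_subset).1 h1
    have hconst : ∀ᶠ s in 𝓝[≥] t, config σ K t x = config σ K s x := by
      filter_upwards [Ico_mem_nhdsGE hb] with s hs
      have : stir K t x = stir K s x := stir_eq_of_no_jump hs.1 fun u htu hus hu =>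
        hu (leftLim_eq_of_const htu (lt_of_le_of_lt hus hs.2)
          fun v hv => hsub ⟨hv.1.le, hv.2⟩)
      simp only [config, this]
    exact tendsto_const_nhds.congr' hconst
  · have hx : ∀ x, ∃ l, Tendsto (fun s => config σ K s x) (𝓝[<] t) (𝓝 l) := by
      intro x
      rcases eq_or_lt_of_le (zero_le (a := t)) with h0 | h0
      · refine ⟨false, ?_⟩
        have : Set.Iio t = (∅ : Set ℝ≥0) := by
          rw [← h0]; ext u; simp
        rw [this, nhdsWithin_empty]
        exact tendsto_bot
      · obtain ⟨n, hn⟩ := (hK.isCadlag x).2 t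
        rw [nhds_discrete, tendsto_pure] at hn
        obtain ⟨a, ha, hsub⟩ := (mem_nhdsLT_iff_exists_Ioo_subset' h0).1 hn
        obtain ⟨m, ham, hmt⟩ := exists_between (Set.mem_Iio.1 ha)
        refine ⟨config σ K m x, ?_⟩
        refine tendsto_const_nhds.congr' ?_
        filter_upwards [Ioo_mem_nhdsLT hmt] with s hs
        have : stir K m x = stir K s x := stir_eq_of_no_jump hs.1.le fun u hmu hus hu =>
          hu (leftLim_eq_of_const (ham.trans hmu) (lt_of_le_of_lt hus hs.2) fun v hv => hsub hv)
        simp only [config, this]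
    choose l hl using hx
    exact ⟨l, tendsto_pi_nhds.2 hl⟩

open Classical in
/-- The path `η_·^σ[𝒦]` for `𝒦 ∈ Γ_*` (its value for other `𝒦` is never used). -/
def configPath (σ : S → Bool) (K : Clocks S) : CadlagPath (S → Bool) :=
  if h : K ∈ gammaStar S then ⟨config σ K, isCadlag_config σ h.1⟩
  else ⟨fun _ => σ, fun _ => continuousWithinAt_const, fun _ => ⟨σ, tendsto_const_nhds⟩⟩

/-- The law `P^σ(A) = Pr(𝒦 ∈ Γ_* : η_·^σ[𝒦] ∈ A)` of the exclusion process started at `σ`. -/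
def exclusionLaw (Pr : Measure (Clocks S)) (σ : S → Bool) : Measure (CadlagPath (S → Bool)) :=
  (Pr.restrict (gammaStar S)).map (configPath σ)

end Stirring

end SSEP

end

/-!
The exploration that computes `X_t^x` backward in time is, in law, the random walk with conductances
`c` started at `x`; non-explosion of the walk therefore makes it stop almost surely, and all other
claims follow from the stirring construction on a set of full probability.

*Termination.* The identity in law is avoided. Almost every realization of the clocks is regular
(`IsPoissonClockLaw.ae_regular`): the counters have unit jumps, no two clocks ring simultaneously,
and finitely many clocks at a site ring in finite time. For regular clocks, the event that the
exploration stops after at most `n` moves is expressed by the increments of the clocks between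
rational times (`Reach`, `stir_eq_some_iff_reach`), which makes it measurable with respect to the
clocks up to time `t`. Its probability `reachProb` is compared with the probability `fewJumps` that
the walk makes fewer than `n` jumps up to time `t`. Splitting the exploration at its first step
`h` backward in time (no ring at `x`, or a single ring of one pair `{x, y}`) gives a lower bound for
`reachProb` (`le_reachProb_succ`); splitting the walk at its first jump and using that the
exponential law has no memory gives an upper bound for `fewJumps` (`fewJumps_succ_le`). The two
bounds agree up to `o(h)`, so that `fewJumps ≤ reachProb` (`fewJumps_le_reachProb`). As `n → ∞`,
`fewJumps` tends to `1` by non-explosion (`tendsto_fewJumps`). Hence the exploration stops almost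
surely, for all sites and all rational times, and then for all times by right-continuity
(`IsPoissonClockLaw.ae_mem_gammaStar`).

*Markov property.* The clocks restarted at time `t` have the original law and are independent of the
clocks up to time `t` (`IsPoissonClockLaw.map_restart`, `IsPoissonClockLaw.indep_past_restart`). The
stirring construction is a flow: exploring back from `t + s` to `t` and then from `t` to `0` is
exploring back from `t + s` (`config_add`). Together these give the Markov property, integrated over
an event of the past (`IsPoissonClockLaw.exclusionLaw_inter_shift`), and the semigroup property.

*Continuity.* For fixed clocks, each coordinate of `η_t^σ` is a coordinate of `σ`, so that
`σ ↦ η_t^σ` is continuous and the Feller property follows by dominated convergence. A continuous `f`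
depends up to `ε` on finitely many coordinates, and with probability tending to `1` as `t ↓ 0` no
clock at these finitely many sites rings up to time `t`; this gives the strong continuity of the
semigroup, uniformly in `σ`.
-/

namespace SSEP

section

/-! ### Càdlàg paths with values in `ℕ` -/

theorem nhdsLT_neBot {u : ℝ≥0} (hu : 0 < u) : (𝓝[<] u).NeBot :=
  mem_closure_iff_nhdsWithin_neBot.1 (by
    rw [closure_Iio' (a := u) ⟨0, hu⟩]; exact Set.mem_Iic.2 le_rfl)

theorem pos_of_mem_jumpTimes {ζ : ℝ≥0 → ℕ} {u : ℝ≥0} (h : u ∈ jumpTimes ζ) : 0 < u := by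
  rcases eq_or_lt_of_le (zero_le (a := u)) with h0 | h0
  · refine absurd (leftLim_eq_of_eq_bot ζ ?_) h
    have : Set.Iio u = (∅ : Set ℝ≥0) := by rw [← h0]; ext; simp
    rw [this, nhdsWithin_empty]
  · exact h0

theorem IsCadlag.eventually_right {ζ : ℝ≥0 → ℕ} (h : IsCadlag ζ) (u : ℝ≥0) :
    ∀ᶠ v in 𝓝[≥] u, ζ v = ζ u := by
  have := h.1 u
  rwa [ContinuousWithinAt, nhds_discrete, tendsto_pure] at this

theorem IsCadlag.eventually_left {ζ : ℝ≥0 → ℕ} (h : IsCadlag ζ) {u : ℝ≥0} (hu : 0 < u) :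
    ∀ᶠ v in 𝓝[<] u, ζ v = Function.leftLim ζ u := by
  have := nhdsLT_neBot hu
  obtain ⟨l, hl⟩ := h.2 u
  rw [leftLim_eq_of_tendsto hl]
  rwa [nhds_discrete, tendsto_pure] at hl

theorem isCadlag_of_eventually {ζ : ℝ≥0 → ℕ} (hr : ∀ u, ∀ᶠ v in 𝓝[≥] u, ζ v = ζ u)
    (hl : ∀ u, 0 < u → ∃ n, ∀ᶠ v in 𝓝[<] u, ζ v = n) : IsCadlag ζ := by
  refine ⟨fun u => ?_, fun u => ?_⟩
  · rw [ContinuousWithinAt, nhds_discrete, tendsto_pure]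
    exact hr u
  · rcases eq_or_lt_of_le (zero_le (a := u)) with h0 | h0
    · refine ⟨0, ?_⟩
      have : Set.Iio u = (∅ : Set ℝ≥0) := by rw [← h0]; ext; simp
      rw [this, nhdsWithin_empty]
      exact tendsto_bot
    · obtain ⟨n, hn⟩ := hl u h0
      refine ⟨n, ?_⟩
      rwa [nhds_discrete, tendsto_pure]

theorem leftLim_eq_of_eventually {ζ : ℝ≥0 → ℕ} {u : ℝ≥0} (hu : 0 < u) {n : ℕ}
    (h : ∀ᶠ v in 𝓝[<] u, ζ v = n) : Function.leftLim ζ u = n := by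
  have := nhdsLT_neBot hu
  refine leftLim_eq_of_tendsto ?_
  rwa [nhds_discrete, tendsto_pure]

theorem not_mem_jumpTimes_of_eq {ζ : ℝ≥0 → ℕ} (hm : Monotone ζ) {q r u : ℝ≥0} (hqu : q < u)
    (hur : u ≤ r) (h : ζ q = ζ r) : u ∉ jumpTimes ζ := by
  have hc : ∀ v, q ≤ v → v ≤ r → ζ v = ζ q := fun v h1 h2 =>
    le_antisymm ((hm h2).trans h.ge) (hm h1)
  refine not_not.2 ?_
  rw [hc u hqu.le hur]
  refine leftLim_eq_of_eventually (zero_le.trans_lt hqu) ?_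
  filter_upwards [Ioo_mem_nhdsLT hqu] with v hv using hc v hv.1.le (hv.2.le.trans hur)

theorem IsCadlag.eq_of_no_jump {ζ : ℝ≥0 → ℕ} (h : IsCadlag ζ) {q r : ℝ≥0} (hqr : q ≤ r)
    (hj : ∀ u, q < u → u ≤ r → u ∉ jumpTimes ζ) : ζ q = ζ r := by
  have hc : ContinuousOn ζ (Set.Icc q r) := by
    intro v hv
    rcases eq_or_lt_of_le hv.1 with rfl | hqv
    · exact (h.1 q).mono fun w hw => hw.1
    · have hl : ContinuousWithinAt ζ (Set.Iio v) v := by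
        rw [ContinuousWithinAt, nhds_discrete, tendsto_pure]
        filter_upwards [h.eventually_left (zero_le.trans_lt hqv)] with w hw
        rw [hw]
        exact not_not.1 (hj v hqv hv.2)
      exact (hl.union (h.1 v)).mono fun w _ => lt_or_ge w v
  exact isPreconnected_Icc.constant hc ⟨le_rfl, hqr⟩ ⟨hqr, le_rfl⟩

theorem exists_jump_of_lt {ζ : ℝ≥0 → ℕ} (h : IsCadlag ζ) {q r : ℝ≥0} (hqr : q ≤ r)
    (hlt : ζ q < ζ r) : ∃ u ∈ jumpTimes ζ, q < u ∧ u ≤ r := by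
  by_contra! hcon
  exact hlt.ne (h.eq_of_no_jump hqr fun u h1 h2 hu => absurd h2 (not_le.2 (hcon u hu h1)))

theorem lt_of_mem_jumpTimes {ζ : ℝ≥0 → ℕ} (hm : Monotone ζ) {q u : ℝ≥0} (hqu : q < u)
    (hu : u ∈ jumpTimes ζ) : ζ q < ζ u :=
  lt_of_le_of_ne (hm hqu.le) fun h => not_mem_jumpTimes_of_eq hm hqu le_rfl h hu

/-! ### Regular realizations of the clocks -/

variable {S : Type*}

/-- The pairs containing the site `x`. -/
def star (x : S) : Set (Edge S) := {e | x ∈ e.1}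

/-- A realization of the clocks with all the regularity that holds almost surely: the counters do
not decrease and have unit jumps, at pairwise different times, and up to any time only finitely many
of the clocks at a given site have rung. -/
structure Regular (K : Clocks S) : Prop where
  mono : ∀ e, Monotone (K e).1
  unitJumps : ∀ e, UnitJumps (K e).1
  disjoint : ∀ e e', e ≠ e' → Disjoint (jumpTimes (K e).1) (jumpTimes (K e').1)
  finite : ∀ x t, {e ∈ star x | (K e).1 t ≠ 0}.Finite

theorem edge_mem_star {x y : S} (h : x ≠ y) : edge h ∈ star x := by simp [edge, star]

theorem exists_edge_of_mem_star {x : S} {e : Edge S} (he : e ∈ star x) :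
    ∃ y, ∃ h : x ≠ y, e = edge h := by
  obtain ⟨s, hs⟩ := e
  obtain ⟨y, rfl⟩ : ∃ y, s = s(x, y) := he
  exact ⟨y, by simpa using hs, rfl⟩

theorem edge_injective (x : S) : Function.Injective fun y : {y // x ≠ y} => edge y.2 := by
  rintro ⟨y, hy⟩ ⟨z, hz⟩ h
  have h' : s(x, y) = s(x, z) := congrArg Subtype.val h
  exact Subtype.ext (Sym2.congr_right.1 h')

theorem edge_eq_iff {x y z : S} (hy : x ≠ y) (hz : x ≠ z) : edge hy = edge hz ↔ y = z :=
  ⟨fun h => congrArg Subtype.val (@edge_injective S x ⟨y, hy⟩ ⟨z, hz⟩ h), fun h => by subst h; rfl⟩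

namespace Regular

variable {K : Clocks S}

theorem finite_neighbours (hK : Regular K) (x : S) (t : ℝ≥0) :
    {y : {y // x ≠ y} | (K (edge y.2)).1 t ≠ 0}.Finite :=
  Set.Finite.of_finite_image ((hK.finite x t).subset (by
    rintro _ ⟨y, hy, rfl⟩
    exact ⟨edge_mem_star y.2, hy⟩)) (edge_injective x).injOn

theorem eventually_right (hK : Regular K) (x : S) (u : ℝ≥0) :
    ∀ᶠ v in 𝓝[≥] u, ∀ e ∈ star x, (K e).1 v = (K e).1 u := by
  have h1 : ∀ᶠ v in 𝓝[≥] u, ∀ e ∈ {e ∈ star x | (K e).1 (u + 1) ≠ 0}, (K e).1 v = (K e).1 u :=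
    (hK.finite x (u + 1)).eventually_all.2 fun e _ => (K e).2.eventually_right u
  have h2 : Set.Ico u (u + 1) ∈ 𝓝[≥] u := Ico_mem_nhdsGE (by simp)
  filter_upwards [h1, h2] with v hv hv2 e he
  by_cases h0 : (K e).1 (u + 1) = 0
  · have h3 := hK.mono e hv2.2.le
    have h4 := hK.mono e hv2.1
    omega
  · exact hv e ⟨he, h0⟩

theorem eventually_left (hK : Regular K) (x : S) {u : ℝ≥0} (hu : 0 < u) :
    ∀ᶠ v in 𝓝[<] u, ∀ e ∈ star x, (K e).1 v = Function.leftLim (K e).1 u := by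
  have h1 : ∀ᶠ v in 𝓝[<] u, ∀ e ∈ {e ∈ star x | (K e).1 u ≠ 0},
      (K e).1 v = Function.leftLim (K e).1 u :=
    (hK.finite x u).eventually_all.2 fun e _ => (K e).2.eventually_left hu
  filter_upwards [h1, self_mem_nhdsWithin] with v hv hv2 e he
  by_cases h0 : (K e).1 u = 0
  · have h3 := hK.mono e (le_of_lt (Set.mem_Iio.1 hv2))
    have h4 := (hK.mono e).leftLim_le (le_refl u)
    omega
  · exact hv e ⟨he, h0⟩

theorem siteClock_right (hK : Regular K) (x : S) (u : ℝ≥0) :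
    ∀ᶠ v in 𝓝[≥] u, siteClock K x v = siteClock K x u := by
  filter_upwards [hK.eventually_right x u] with v hv
  exact tsum_congr fun y => hv _ (edge_mem_star y.2)

theorem siteClock_left (hK : Regular K) (x : S) {u : ℝ≥0} (hu : 0 < u) :
    ∀ᶠ v in 𝓝[<] u, siteClock K x v =
      ∑' y : {y // x ≠ y}, Function.leftLim (K (edge y.2)).1 u := by
  filter_upwards [hK.eventually_left x hu] with v hv
  exact tsum_congr fun y => hv _ (edge_mem_star y.2)

theorem isCadlag_siteClock (hK : Regular K) (x : S) : IsCadlag (siteClock K x) :=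
  isCadlag_of_eventually (hK.siteClock_right x) fun _ hu => ⟨_, hK.siteClock_left x hu⟩

theorem leftLim_siteClock (hK : Regular K) (x : S) {u : ℝ≥0} (hu : 0 < u) :
    Function.leftLim (siteClock K x) u =
      ∑ y ∈ (hK.finite_neighbours x u).toFinset, Function.leftLim (K (edge y.2)).1 u := by
  rw [leftLim_eq_of_eventually hu (hK.siteClock_left x hu)]
  refine tsum_eq_sum fun y hy => ?_
  have h0 : (K (edge y.2)).1 u = 0 := by simpa using hy
  have := (hK.mono (edge y.2)).leftLim_le (le_refl u)
  omega

theorem siteClock_eq_sum (hK : Regular K) (x : S) (u : ℝ≥0) :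
    siteClock K x u = ∑ y ∈ (hK.finite_neighbours x u).toFinset, (K (edge y.2)).1 u := by
  refine tsum_eq_sum fun y hy => ?_
  simpa using hy

theorem leftLim_edge (hK : Regular K) {e e' : Edge S} (h : e' ≠ e) {u : ℝ≥0}
    (hu : u ∈ jumpTimes (K e).1) : Function.leftLim (K e').1 u = (K e').1 u := by
  by_contra hne
  exact Set.disjoint_left.1 (hK.disjoint e' e h) hne hu

theorem siteClock_jump (hK : Regular K) {x y : S} (h : x ≠ y) {u : ℝ≥0}
    (hu : u ∈ jumpTimes (K (edge h)).1) :
    siteClock K x u = Function.leftLim (siteClock K x) u + 1 := by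
  classical
  rw [hK.leftLim_siteClock x (pos_of_mem_jumpTimes hu), hK.siteClock_eq_sum]
  have hmem : (⟨y, h⟩ : {y // x ≠ y}) ∈ (hK.finite_neighbours x u).toFinset := by
    have := hK.unitJumps (edge h) u hu
    simp only [Set.Finite.mem_toFinset, Set.mem_ofPred_eq]
    omega
  rw [← Finset.add_sum_erase _ _ hmem, ← Finset.add_sum_erase _ _ hmem,
    hK.unitJumps (edge h) u hu, add_right_comm]
  congr 2
  refine Finset.sum_congr rfl fun z hz => (hK.leftLim_edge (fun he => ?_) hu).symm
  exact Finset.ne_of_mem_erase hz (edge_injective x he)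

theorem mem_jumpTimes_siteClock (hK : Regular K) (x : S) (u : ℝ≥0) :
    u ∈ jumpTimes (siteClock K x) ↔ ∃ e ∈ star x, u ∈ jumpTimes (K e).1 := by
  refine ⟨fun hu => ?_, ?_⟩
  · by_contra! hcon
    refine hu ?_
    rw [hK.leftLim_siteClock x (pos_of_mem_jumpTimes hu), hK.siteClock_eq_sum]
    exact Finset.sum_congr rfl fun y _ => not_not.1 (hcon _ (edge_mem_star y.2))
  · rintro ⟨e, he, hu⟩
    obtain ⟨y, h, rfl⟩ := exists_edge_of_mem_star he
    have := hK.siteClock_jump h hu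
    simp only [jumpTimes, Set.mem_ofPred_eq]
    omega

theorem inGamma (hK : Regular K) : InGamma K where
  finite x t := summable_of_hasFiniteSupport (hK.finite_neighbours x t)
  isCadlag := hK.isCadlag_siteClock
  unitJumps_site x u hu := by
    obtain ⟨e, he, hu⟩ := (hK.mem_jumpTimes_siteClock x u).1 hu
    obtain ⟨y, h, rfl⟩ := exists_edge_of_mem_star he
    exact hK.siteClock_jump h hu
  unitJumps := hK.unitJumps
  disjoint := hK.disjoint

theorem unique_edge (hK : Regular K) {e e' : Edge S} {u : ℝ≥0} (h : u ∈ jumpTimes (K e).1)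
    (h' : u ∈ jumpTimes (K e').1) : e = e' := by
  by_contra hne
  exact Set.disjoint_left.1 (hK.disjoint e e' hne) h h'

end Regular

/-! ### The backward exploration -/

theorem Explore.congr {K : Clocks S} {x z : S} {U V : Set ℝ≥0}
    (hUV : jumpTimes (siteClock K x) ∩ U = jumpTimes (siteClock K x) ∩ V)
    (h : Explore K x U z) : Explore K x V z := by
  cases h with
  | halt h => exact .halt (hUV ▸ h)
  | move hu hxy hy h => exact .move (hUV ▸ hu) hxy hy h

theorem Explore.unique {K : Clocks S} (hK : Regular K) {x z z' : S} {U : Set ℝ≥0}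
    (h : Explore K x U z) (h' : Explore K x U z') : z = z' := by
  induction h generalizing z' with
  | halt h =>
    cases h' with
    | halt => rfl
    | move hu => exact absurd hu.1 (by rw [h]; exact Set.notMem_empty _)
  | move hu hxy hy _ ih =>
    cases h' with
    | halt h => exact absurd hu.1 (by rw [h]; exact Set.notMem_empty _)
    | move hu' hxy' hy' h' =>
      obtain rfl := hu.unique hu'
      obtain rfl := (edge_eq_iff hxy hxy').1 (hK.unique_edge hy hy')
      exact ih h'

theorem stir_eq_some_iff {K : Clocks S} (hK : Regular K) {t : ℝ≥0} {x z : S} :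
    stir K t x = some z ↔ Explore K x (Set.Iic t) z := by
  unfold stir
  split_ifs with h
  · rw [Option.some_inj]
    exact ⟨fun hz => hz ▸ h.choose_spec, fun hz => h.choose_spec.unique hK hz⟩
  · simp only [false_iff]
    exact fun hz => h ⟨z, hz⟩

/-! ### The exploration in terms of increments at countably many times -/

/-- None of the clocks in `B` rings during `(q, r]`. -/
def Quiet (K : Clocks S) (B : Set (Edge S)) (q r : ℝ≥0) : Prop :=
  ∀ e ∈ B, (K e).1 q = (K e).1 r

/-- During `(q, r]` the clock of the pair `{x, y}` rings once, and no other clock at `x` or `y`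
rings. -/
def SingleRing (K : Clocks S) {x y : S} (h : x ≠ y) (q r : ℝ≥0) : Prop :=
  (K (edge h)).1 r = (K (edge h)).1 q + 1 ∧ Quiet K ((star x ∪ star y) \ {edge h}) q r

/-- The rational times. -/
def ratTimes : Set ℝ≥0 := Set.range fun q : ℚ≥0 => (q : ℝ≥0)

/-- The exploration from `x` of the jump times in `[0, t]` stops at `z` after at most `n` moves,
expressed through the increments of the clocks over intervals with endpoints in the countable set
of the rational times and `t`. Each move `{x, y}` is localized in an interval `(q, r]` in which no
other clock at `x` or `y` rings. -/
def Reach (K : Clocks S) : ℕ → S → ℝ≥0 → S → Prop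
  | 0, x, t, z => x = z ∧ Quiet K (star x) 0 t
  | n + 1, x, t, z => (x = z ∧ Quiet K (star x) 0 t) ∨
      ∃ y, ∃ h : x ≠ y, ∃ q ∈ ratTimes, ∃ r ∈ insert t ratTimes, q ≤ r ∧ r ≤ t ∧
        Quiet K (star x) r t ∧ SingleRing K h q r ∧ Reach K n y q z

theorem Quiet.trans {K : Clocks S} {B : Set (Edge S)} {q r s : ℝ≥0} (h : Quiet K B q r)
    (h' : Quiet K B r s) : Quiet K B q s := fun e he => (h e he).trans (h' e he)

theorem Reach.extend {K : Clocks S} {n : ℕ} {x z : S} {s t : ℝ≥0} (hs : s ∈ ratTimes) (hst : s ≤ t)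
    (h : Reach K n x s z) (hq : Quiet K (star x) s t) : Reach K n x t z := by
  cases n with
  | zero => exact ⟨h.1, h.2.trans hq⟩
  | succ n =>
    rcases h with h | ⟨y, hxy, q, hqD, r, hr, hqr, hrt, h1, h2, h3⟩
    · exact .inl ⟨h.1, h.2.trans hq⟩
    · refine .inr ⟨y, hxy, q, hqD, r, Set.mem_insert_of_mem _ ?_, hqr, hrt.trans hst,
        h1.trans hq, h2, h3⟩
      rcases hr with rfl | hr
      · exact hs
      · exact hr

theorem Reach.move {K : Clocks S} {n : ℕ} {x y z : S} (h : x ≠ y) {s t : ℝ≥0} (hs : s ∈ ratTimes)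
    (hst : s ≤ t) (h1 : SingleRing K h s t) (h2 : Reach K n y s z) : Reach K (n + 1) x t z :=
  .inr ⟨y, h, s, hs, t, Set.mem_insert _ _, hst, le_rfl, fun _ _ => rfl, h1, h2⟩

theorem Regular.no_jump_of_quiet {K : Clocks S} (hK : Regular K) {x : S} {q r u : ℝ≥0}
    (h : Quiet K (star x) q r) (hq : q < u) (hr : u ≤ r) : u ∉ jumpTimes (siteClock K x) := by
  rw [hK.mem_jumpTimes_siteClock]
  rintro ⟨e, he, hu⟩
  exact not_mem_jumpTimes_of_eq (hK.mono e) hq hr (h e he) hu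

theorem Reach.explore {K : Clocks S} (hK : Regular K) {n : ℕ} {x z : S} {t : ℝ≥0}
    (h : Reach K n x t z) : Explore K x (Set.Iic t) z := by
  have halt : ∀ {x t}, (x = z ∧ Quiet K (star x) 0 t) → Explore K x (Set.Iic t) z := by
    rintro x t ⟨rfl, hq⟩
    refine .halt (Set.eq_empty_of_forall_notMem ?_)
    rintro u ⟨hu, hut⟩
    exact hK.no_jump_of_quiet hq (pos_of_mem_jumpTimes hu) hut hu
  induction n generalizing x t with
  | zero => exact halt h
  | succ n ih =>
    rcases h with h | ⟨y, hxy, q, -, r, -, hqr, hrt, h1, ⟨h2, h3⟩, h4⟩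
    · exact halt h
    obtain ⟨u, hu, hqu, hur⟩ := exists_jump_of_lt (K (edge hxy)).2 hqr (by rw [h2]; omega)
    -- no clock at `x` or `y` rings in `(q, r]` at a time other than `u`
    have key : ∀ e ∈ star x ∪ star y, ∀ v ∈ jumpTimes (K e).1, q < v → v ≤ r → v = u := by
      intro e he v hv hqv hvr
      by_cases hee : e = edge hxy
      · subst hee
        rcases lt_trichotomy v u with h | h | h
        · have a1 := lt_of_mem_jumpTimes (hK.mono _) hqv hv
          have a2 := lt_of_mem_jumpTimes (hK.mono _) h hu
          have a3 := hK.mono (edge hxy) hur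
          omega
        · exact h
        · have a1 := lt_of_mem_jumpTimes (hK.mono _) hqu hu
          have a2 := lt_of_mem_jumpTimes (hK.mono _) h hv
          have a3 := hK.mono (edge hxy) hvr
          omega
      · exact absurd hv (not_mem_jumpTimes_of_eq (hK.mono e) hqv hvr (h3 e ⟨he, hee⟩))
    refine .move (u := u) ⟨⟨?_, hur.trans hrt⟩, ?_⟩ hxy hu ?_
    · exact (hK.mem_jumpTimes_siteClock x u).2 ⟨_, edge_mem_star hxy, hu⟩
    · rintro v ⟨hv, hvt⟩
      by_contra! huv
      by_cases hvr : v ≤ r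
      · obtain ⟨e, he, hv⟩ := (hK.mem_jumpTimes_siteClock x v).1 hv
        exact huv.ne' (key e (.inl he) v hv (hqu.trans huv) hvr)
      · exact hK.no_jump_of_quiet h1 (not_le.1 hvr) hvt hv
    · refine (ih h4).congr ?_
      ext v
      refine ⟨fun hv => ⟨hv.1, lt_of_le_of_lt hv.2 hqu⟩, fun hv => ⟨hv.1, ?_⟩⟩
      by_contra hqv
      obtain ⟨e, he, hv'⟩ := (hK.mem_jumpTimes_siteClock y v).1 hv.1
      have h5 : v < u := hv.2
      exact h5.ne (key e (.inr he) v hv' (not_le.1 hqv) (h5.le.trans hur))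

theorem exists_ratTimes_between {a b : ℝ≥0} (h : a < b) : ∃ q ∈ ratTimes, a < q ∧ q < b := by
  obtain ⟨q, h1, h2⟩ := NNReal.lt_iff_exists_rat_btwn a b |>.1 h
  refine ⟨_, ⟨Rat.toNNRat q, rfl⟩, ?_⟩
  have : ((Rat.toNNRat q : ℚ≥0) : ℝ≥0) = Real.toNNReal q := by
    ext
    rw [Real.coe_toNNReal _ (by exact_mod_cast h1)]
    have : ((q.toNNRat : ℚ≥0) : ℚ) = q := Rat.coe_toNNRat q h1
    conv_rhs => rw [← this]
    norm_cast
  simp only [this]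
  exact h2

theorem Explore.exists_reach {K : Clocks S} (hK : Regular K) {x z : S} {U : Set ℝ≥0}
    (h : Explore K x U z) {t : ℝ≥0}
    (hU : jumpTimes (siteClock K x) ∩ U = jumpTimes (siteClock K x) ∩ Set.Iic t) :
    ∃ n, Reach K n x t z := by
  induction h generalizing t with
  | @halt x U h =>
    refine ⟨0, rfl, fun e he => (K e).2.eq_of_no_jump zero_le fun u _ hut hu => ?_⟩
    have : u ∈ jumpTimes (siteClock K x) ∩ U := by
      rw [hU]
      exact ⟨(hK.mem_jumpTimes_siteClock x u).2 ⟨e, he, hu⟩, hut⟩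
    rw [h] at this
    exact this
  | @move x y z U u hu hxy hy _ ih =>
    rw [hU] at hu
    have hu0 := pos_of_mem_jumpTimes hy
    -- a rational time `q < u` with no ring at `x` or `y` in `[q, u)`
    have hleft := (hK.eventually_left x hu0).and (hK.eventually_left y hu0)
    obtain ⟨a, ha, hsub⟩ := (mem_nhdsLT_iff_exists_Ioo_subset' hu0).1 hleft
    obtain ⟨q, hq, haq, hqu⟩ := exists_ratTimes_between ha
    -- an admissible time `r ≥ u` with no ring at `x` or `y` in `(u, r]`
    obtain ⟨r, hr, hur, hrt, hrx, hry⟩ : ∃ r ∈ insert t ratTimes, u ≤ r ∧ r ≤ t ∧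
        (∀ e ∈ star x, (K e).1 r = (K e).1 u) ∧ ∀ e ∈ star y, (K e).1 r = (K e).1 u := by
      rcases eq_or_lt_of_le (show u ≤ t from hu.1.2) with rfl | hut
      · exact ⟨u, Set.mem_insert _ _, le_rfl, le_rfl, fun _ _ => rfl, fun _ _ => rfl⟩
      · have hright := (hK.eventually_right x u).and (hK.eventually_right y u)
        obtain ⟨b, hb, hsub'⟩ := (mem_nhdsGE_iff_exists_Ico_subset' hut).1 hright
        obtain ⟨r, hr, hur, hrb⟩ := exists_ratTimes_between (lt_min (Set.mem_Ioi.1 hb) hut)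
        have := hsub' ⟨hur.le, hrb.trans_le (min_le_left _ _)⟩
        exact ⟨r, Set.mem_insert_of_mem _ hr, hur.le, (hrb.trans_le (min_le_right _ _)).le,
          this.1, this.2⟩
    obtain ⟨n, hn⟩ := ih (t := q) (by
      ext v
      refine ⟨fun hv => ⟨hv.1, ?_⟩, fun hv => ⟨hv.1, lt_of_le_of_lt hv.2 hqu⟩⟩
      by_contra hqv
      obtain ⟨e, he, hv'⟩ := (hK.mem_jumpTimes_siteClock y v).1 hv.1
      have h1 : v < u := hv.2
      have h2 : q < v := not_le.1 hqv
      have h3 : (K e).1 q = (K e).1 v := ((hsub ⟨haq, hqu⟩).2 e he).trans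
        ((hsub ⟨haq.trans h2, h1⟩).2 e he).symm
      exact not_mem_jumpTimes_of_eq (hK.mono e) h2 le_rfl h3 hv')
    refine ⟨n + 1, .inr ⟨y, hxy, q, hq, r, hr, hqu.le.trans hur, hrt, ?_, ⟨?_, ?_⟩, hn⟩⟩
    · refine fun e he => (K e).2.eq_of_no_jump hrt fun v hrv hvt hv => ?_
      exact absurd (hu.2 ⟨(hK.mem_jumpTimes_siteClock x v).2 ⟨e, he, hv⟩, hvt⟩)
        (not_le.2 (hur.trans_lt hrv))
    · rw [hrx _ (edge_mem_star hxy), (hsub ⟨haq, hqu⟩).1 _ (edge_mem_star hxy)]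
      exact hK.unitJumps _ u hy
    · rintro e ⟨he, hne⟩
      have h1 := hK.leftLim_edge hne hy
      rcases he with he | he
      · rw [hrx e he, (hsub ⟨haq, hqu⟩).1 e he, h1]
      · rw [hry e he, (hsub ⟨haq, hqu⟩).2 e he, h1]

theorem stir_eq_some_iff_reach {K : Clocks S} (hK : Regular K) {t : ℝ≥0} {x z : S} :
    stir K t x = some z ↔ ∃ n, Reach K n x t z := by
  rw [stir_eq_some_iff hK]
  exact ⟨fun h => h.exists_reach hK rfl, fun ⟨_, h⟩ => h.explore hK⟩

/-- By right-continuity, termination at rational times gives termination at all times. -/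
theorem Regular.stir_ne_none {K : Clocks S} (hK : Regular K)
    (h : ∀ x, ∀ q ∈ ratTimes, ∃ n z, Reach K n x q z) (t : ℝ≥0) (x : S) : stir K t x ≠ none := by
  obtain ⟨b, hb, hsub⟩ := mem_nhdsGE_iff_exists_Ico_subset.1 (hK.eventually_right x t)
  obtain ⟨q, hq, htq, hqb⟩ := exists_ratTimes_between (Set.mem_Ioi.1 hb)
  obtain ⟨n, z, hz⟩ := h x q hq
  rw [stir_eq_of_no_jump htq.le (fun u htu huq => hK.no_jump_of_quiet
    (fun e he => (hsub ⟨htq.le, hqb⟩ e he).symm) htu huq),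
    (stir_eq_some_iff_reach hK).2 ⟨n, hz⟩]
  simp

/-! ### Restarting the clocks -/

theorem isCadlag_restart {ζ : ℝ≥0 → ℕ} (h : IsCadlag ζ) (t : ℝ≥0) :
    IsCadlag fun s => ζ (t + s) - ζ t := by
  have h' := isCadlag_shift h t
  refine isCadlag_of_eventually (fun u => ?_) fun u hu => ?_
  · filter_upwards [h'.eventually_right u] with v hv
    rw [hv]
  · refine ⟨Function.leftLim (fun s => ζ (t + s)) u - ζ t, ?_⟩
    filter_upwards [h'.eventually_left hu] with v hv
    rw [← hv]

/-- The clocks restarted at time `t`, counting the rings after time `t`. -/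
def restart (t : ℝ≥0) (K : Clocks S) : Clocks S :=
  fun e => ⟨fun s => (K e).1 (t + s) - (K e).1 t, isCadlag_restart (K e).2 t⟩

theorem mem_jumpTimes_restart {K : Clocks S} (hK : Regular K) (t : ℝ≥0) (e : Edge S) (u : ℝ≥0) :
    u ∈ jumpTimes (restart t K e).1 ↔ 0 < u ∧ t + u ∈ jumpTimes (K e).1 := by
  refine ⟨fun h => ⟨pos_of_mem_jumpTimes h, ?_⟩, fun ⟨h0, h⟩ => ?_⟩
  · have h0 := pos_of_mem_jumpTimes h
    obtain ⟨a, hat, ha⟩ := (mem_nhdsLT_iff_exists_Ioo_subset' h0).1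
      ((restart t K e).2.eventually_left h0)
    by_contra hcon
    obtain ⟨v, hav, hvu⟩ := exists_between (Set.mem_Iio.1 hat)
    obtain ⟨b, hbt, hb⟩ := (mem_nhdsLT_iff_exists_Ioo_subset' (h0.trans_le le_add_self)).1
      ((K e).2.eventually_left (u := t + u) (h0.trans_le le_add_self))
    have hbu : b - t < u := by
      rcases le_total b t with hbt' | hbt'
      · rwa [tsub_eq_zero_of_le hbt']
      · exact (tsub_lt_iff_left hbt').2 hbt
    obtain ⟨w, hw1, hw2⟩ := exists_between (max_lt hvu hbu)
    have e1 := ha ⟨hav.trans ((le_max_left _ _).trans_lt hw1), hw2⟩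
    have e2 := hb ⟨show b < t + w from
      lt_add_of_tsub_lt_left ((le_max_right _ _).trans_lt hw1),
      (add_lt_add_iff_left t).2 hw2⟩
    simp only [Set.mem_ofPred_eq] at e1 e2
    refine h ?_
    rw [← e1]
    simp only [restart]
    rw [e2, not_not.1 hcon]
  · have h1 := lt_of_mem_jumpTimes (hK.mono e) (lt_add_of_pos_right t h0) h
    intro hcon
    obtain ⟨a, hat, ha⟩ := (mem_nhdsLT_iff_exists_Ioo_subset' h0).1
      ((restart t K e).2.eventually_left h0)
    obtain ⟨v, hav, hvu⟩ := exists_between (Set.mem_Iio.1 hat)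
    have e1 := ha ⟨hav, hvu⟩
    have h2 := lt_of_mem_jumpTimes (hK.mono e) ((add_lt_add_iff_left t).2 hvu) h
    have h3 := hK.mono e (le_add_right (le_refl t) : t ≤ t + v)
    simp only [Set.mem_ofPred_eq] at e1
    rw [hcon] at e1
    simp only [restart] at e1
    omega

theorem mem_jumpTimes_siteClock_restart {K : Clocks S} (hK : Regular K) {t : ℝ≥0}
    (hK' : Regular (restart t K)) (x : S) (u : ℝ≥0) :
    u ∈ jumpTimes (siteClock (restart t K) x) ↔
      0 < u ∧ t + u ∈ jumpTimes (siteClock K x) := by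
  rw [hK.mem_jumpTimes_siteClock, hK'.mem_jumpTimes_siteClock]
  simp only [mem_jumpTimes_restart hK]
  tauto

/-- The exploration of the restarted clocks, followed by that of the clocks up to time `t`, is an
exploration of the original clocks. -/
theorem Explore.append {K : Clocks S} (hK : Regular K) {t : ℝ≥0} (hK' : Regular (restart t K))
    {x y z : S} {U : Set ℝ≥0} (h : Explore (restart t K) x U y)
    (h' : Explore K y (Set.Iic t) z) : Explore K x (Set.Iic t ∪ (t + ·) '' U) z := by
  induction h with
  | @halt x U h =>
    refine h'.congr ?_
    ext v
    refine ⟨fun hv => ⟨hv.1, .inl hv.2⟩, fun hv => ⟨hv.1, ?_⟩⟩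
    rcases hv with ⟨hv, hvt | ⟨u, hu, rfl⟩⟩
    · exact hvt
    · by_contra hlt
      have : u ∈ jumpTimes (siteClock (restart t K) x) ∩ U :=
        ⟨(mem_jumpTimes_siteClock_restart hK hK' x u).2
          ⟨by simpa [pos_iff_ne_zero] using hlt, hv⟩, hu⟩
      rw [h] at this
      exact this
  | @move x y' y U u hu hxy hy _ ih =>
    have hu0 := pos_of_mem_jumpTimes hy
    refine .move (u := t + u) ⟨⟨?_, .inr ⟨u, hu.1.2, rfl⟩⟩, ?_⟩ hxy
      ((mem_jumpTimes_restart hK t _ u).1 hy).2 ?_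
    · exact ((mem_jumpTimes_siteClock_restart hK hK' x u).1 hu.1.1).2
    · rintro v ⟨hv, hvt | ⟨w, hw, rfl⟩⟩
      · exact (Set.mem_Iic.1 hvt).trans (le_add_right le_rfl)
      · rcases eq_or_lt_of_le (zero_le (a := w)) with h0 | h0
        · simp only [← h0, add_zero]
          exact le_add_right le_rfl
        · exact add_le_add_right
            (hu.2 ⟨(mem_jumpTimes_siteClock_restart hK hK' x w).2 ⟨h0, hv⟩, hw⟩) t
    · have hset : Set.Iio (t + u) = Set.Iic t ∪ (t + ·) '' Set.Iio u := by
        ext v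
        simp only [Set.mem_Iio, Set.mem_union, Set.mem_Iic, Set.mem_image]
        constructor
        · intro hv
          rcases le_or_gt v t with h | h
          · exact .inl h
          · refine .inr ⟨v - t, ?_, add_tsub_cancel_of_le h.le⟩
            exact (tsub_lt_iff_left h.le).2 hv
        · rintro (h | ⟨w, hw, rfl⟩)
          · exact h.trans_lt (lt_add_of_pos_right t hu0)
          · exact (add_lt_add_iff_left t).2 hw
      rw [hset]
      exact ih h'

theorem mem_gammaStar_of_regular {K : Clocks S} (hK : Regular K)
    (h : ∀ t x, stir K t x ≠ none) : K ∈ gammaStar S := ⟨hK.inGamma, h⟩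

/-- The flow property of the stirring construction. -/
theorem config_add {K : Clocks S} (hK : Regular K) {t : ℝ≥0} (hK' : Regular (restart t K))
    (hs : K ∈ gammaStar S) (hs' : restart t K ∈ gammaStar S) (σ : S → Bool) (s : ℝ≥0) :
    config σ K (t + s) = config (config σ K t) (restart t K) s := by
  funext x
  obtain ⟨y, hy⟩ := Option.ne_none_iff_exists'.1 (hs'.2 s x)
  obtain ⟨z, hz⟩ := Option.ne_none_iff_exists'.1 (hs.2 t y)
  have hset : Set.Iic (t + s) = Set.Iic t ∪ (t + ·) '' Set.Iic s := by
    ext v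
    simp only [Set.mem_union, Set.mem_Iic, Set.mem_image]
    constructor
    · intro hv
      rcases le_total v t with h | h
      · exact .inl h
      · exact .inr ⟨v - t, tsub_le_iff_left.2 hv, add_tsub_cancel_of_le h⟩
    · rintro (h | ⟨w, hw, rfl⟩)
      · exact le_add_right h
      · exact add_le_add_right hw t
  have hxz : stir K (t + s) x = some z := by
    rw [stir_eq_some_iff hK, hset]
    exact ((stir_eq_some_iff hK').1 hy).append hK hK' ((stir_eq_some_iff hK).1 hz)
  simp only [config, hxz, hy, hz, Option.elim]

end

section

/-! ### Poisson processes: law and independence of the increments after a fixed time -/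

section Poisson

/-- Finitely many times are visited by a nondecreasing sequence started at `0`. -/
theorem exists_monotone_enum (I : Finset ℝ≥0) :
    ∃ τ : ℕ → ℝ≥0, Monotone τ ∧ τ 0 = 0 ∧ ∀ s ∈ I, ∃ k, τ k = s := by
  obtain ⟨τ, _, h1, h2, -, h3⟩ : ∃ (τ : ℕ → ℝ≥0) (n : ℕ), Monotone τ ∧ τ 0 = 0 ∧
      (∀ k, τ k = 0 ∨ τ k ∈ I) ∧ ∀ s ∈ I, ∃ k, k ≤ n ∧ τ k = s := by
    induction I using Finset.induction_on_max with
    | empty => exact ⟨fun _ => 0, 0, fun _ _ _ => le_rfl, rfl, fun _ => .inl rfl, by simp⟩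
    | insert a I ha ih =>
      obtain ⟨τ, n, h1, h2, h3, h4⟩ := ih
      have hle : ∀ k, τ k ≤ a := fun k => by
        rcases h3 k with h | h
        · rw [h]; exact zero_le
        · exact (ha _ h).le
      refine ⟨fun k => if k ≤ n then τ k else a, n + 1, ?_, by simp [h2], fun k => ?_, ?_⟩
      · intro i j hij
        simp only
        split_ifs with hi hj
        · exact h1 hij
        · exact hle i
        · omega
        · exact le_rfl
      · simp only
        split_ifs with hk
        · exact (h3 k).imp id fun h => Finset.mem_insert_of_mem h
        · exact .inr (Finset.mem_insert_self _ _)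
      · intro s hs
        rcases Finset.mem_insert.1 hs with rfl | hs
        · exact ⟨n + 1, le_rfl, by simp⟩
        · obtain ⟨k, hk, rfl⟩ := h4 s hs
          exact ⟨k, hk.trans n.le_succ, by simp [hk]⟩
  exact ⟨τ, h1, h2, fun s hs => (h3 s hs).imp fun _ h => h.2⟩

variable {Ω : Type*} [MeasurableSpace Ω] {μ : Measure Ω} {N : ℝ≥0 → Ω → ℕ} {r : ℝ≥0}

theorem IsPoissonProcess.ae_eq_sum (hN : IsPoissonProcess μ N r) {τ : ℕ → ℝ≥0} (hτ : Monotone τ)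
    (h0 : τ 0 = 0) :
    ∀ᵐ ω ∂μ, ∀ k, N (τ k) ω = ∑ i ∈ Finset.range k, (N (τ (i + 1)) ω - N (τ i) ω) := by
  filter_upwards [hN.zero, hN.mono] with ω hz hm k
  have := Finset.sum_range_tsub (f := fun i => N (τ i) ω) (fun i j hij => hm (hτ hij)) k
  rw [this, h0, hz, tsub_zero]

/-- The finite-dimensional laws of a Poisson process are images of the product law of the
increments. -/
theorem IsPoissonProcess.map_restrict (hN : IsPoissonProcess μ N r) (hm : ∀ s, Measurable (N s))
    {I : Finset ℝ≥0} {τ : ℕ → ℝ≥0} (hτ : Monotone τ) (h0 : τ 0 = 0) {k : ℝ≥0 → ℕ}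
    (hk : ∀ s ∈ I, τ (k s) = s) :
    μ.map (fun ω => I.restrict fun s => N s ω) =
      (Measure.infinitePi fun i => poissonMeasure (r * (τ (i + 1) - τ i))).map
        fun (d : ℕ → ℕ) (s : I) => ∑ i ∈ Finset.range (k s), d i := by
  have hme : ∀ i, Measurable fun ω => N (τ (i + 1)) ω - N (τ i) ω :=
    fun i => (hm _).sub (hm _)
  have hD : μ.map (fun ω i => N (τ (i + 1)) ω - N (τ i) ω) =
      Measure.infinitePi fun i => poissonMeasure (r * (τ (i + 1) - τ i)) := by
    rw [(hN.indep.nat hτ).map_fun_eq_infinitePi_map hme]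
    congr 1
    funext i
    exact (hN.law _ _ (hτ i.le_succ)).map_eq
  rw [← hD, Measure.map_map (by fun_prop) (measurable_pi_lambda _ hme)]
  refine Measure.map_congr ?_
  filter_upwards [hN.ae_eq_sum hτ h0] with ω hω
  funext s
  have := hω (k s)
  rw [hk s s.2] at this
  exact this

/-- The law of a Poisson process is determined by its intensity. -/
theorem IsPoissonProcess.map_eq {Ω' : Type*} [MeasurableSpace Ω'] {μ' : Measure Ω'}
    {N' : ℝ≥0 → Ω' → ℕ} [IsProbabilityMeasure μ]
    (hN : IsPoissonProcess μ N r) (hN' : IsPoissonProcess μ' N' r) (hm : ∀ s, Measurable (N s))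
    (hm' : ∀ s, Measurable (N' s)) :
    μ.map (fun ω s => N s ω) = μ'.map (fun ω s => N' s ω) := by
  have hX : Measurable fun ω s => N s ω := measurable_pi_lambda _ hm
  have hX' : Measurable fun ω s => N' s ω := measurable_pi_lambda _ hm'
  have := fun I : Finset ℝ≥0 => Measure.isFiniteMeasure_map μ fun ω => I.restrict fun s => N s ω
  refine (isProjectiveLimit_map hX.aemeasurable).unique fun I => ?_
  rw [isProjectiveLimit_map hX'.aemeasurable I]
  obtain ⟨τ, hτ, h0, hI⟩ := exists_monotone_enum I
  choose! k hk using hI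
  beta_reduce
  rw [hN.map_restrict hm hτ h0 hk, hN'.map_restrict hm' hτ h0 hk]

theorem indepFun_of_disjoint {ι : Type*} {D : ι → Ω → ℕ} (hD : iIndepFun D μ)
    (hm : ∀ i, Measurable (D i)) {A B : Set ι} (hAB : Disjoint A B) {β γ : Type*}
    [MeasurableSpace β] [MeasurableSpace γ] {f : Ω → β} {g : Ω → γ}
    (hf : Measurable[⨆ i ∈ A, MeasurableSpace.comap (D i) ⊤] f)
    (hg : Measurable[⨆ i ∈ B, MeasurableSpace.comap (D i) ⊤] g) : IndepFun f g μ := by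
  rw [IndepFun_iff_Indep]
  have h := indep_iSup_of_disjoint (fun i => (hm i).comap_le) hD.iIndep hAB
  exact indep_of_indep_of_le_left (indep_of_indep_of_le_right h hg.comap_le) hf.comap_le

/-- A Poisson process up to time `t` is independent of its increments after time `t`. -/
theorem IsPoissonProcess.indepFun_past_future [IsProbabilityMeasure μ]
    (hN : IsPoissonProcess μ N r) (hm : ∀ s, Measurable (N s)) (t : ℝ≥0) :
    IndepFun (fun ω (s : ℝ≥0) => N (min s t) ω) (fun ω (s : ℝ≥0) => N (t + s) ω - N t ω) μ := by
  classical
  refine IndepFun.process_indepFun_process (X := fun s ω => N (min s t) ω)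
    (Y := fun s ω => N (t + s) ω - N t ω) (fun s => hm _) (fun s => (hm _).sub (hm _))
    fun I J => ?_
  obtain ⟨τ, hτ, h0, hI⟩ := exists_monotone_enum
    (insert t (I.image (min · t) ∪ J.image (t + ·)))
  obtain ⟨m, hmt⟩ := hI t (Finset.mem_insert_self _ _)
  have hpast : ∀ s : I, ∃ k ≤ m, τ k = min (s : ℝ≥0) t := fun s => by
    obtain ⟨k, hk⟩ := hI (min s t) (Finset.mem_insert_of_mem (Finset.mem_union_left _
      (Finset.mem_image_of_mem _ s.2)))
    rcases le_total k m with h | h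
    · exact ⟨k, h, hk⟩
    · refine ⟨m, le_rfl, le_antisymm (hk ▸ hτ h) ?_⟩
      rw [hmt]
      exact min_le_right _ _
  have hfut : ∀ s : J, ∃ l ≥ m, τ l = t + (s : ℝ≥0) := fun s => by
    obtain ⟨k, hk⟩ := hI (t + s) (Finset.mem_insert_of_mem (Finset.mem_union_right _
      (Finset.mem_image_of_mem (t + ·) s.2)))
    rcases le_total m k with h | h
    · exact ⟨k, h, hk⟩
    · refine ⟨m, le_rfl, le_antisymm ?_ (hk ▸ hτ h)⟩
      rw [hmt]
      exact le_add_right le_rfl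
  choose k hkm hk using hpast
  choose l hlm hl using hfut
  let D : ℕ → Ω → ℕ := fun i ω => N (τ (i + 1)) ω - N (τ i) ω
  have hDm : ∀ i, Measurable (D i) := fun i => (hm _).sub (hm _)
  have hsum : ∀ (A : Set ℕ) (F : Finset ℕ), (∀ i ∈ F, i ∈ A) →
      Measurable[⨆ i ∈ A, MeasurableSpace.comap (D i) ⊤] fun ω => ∑ i ∈ F, D i ω := by
    intro A F hF
    refine Finset.measurable_sum F fun i hi => ?_
    exact (comap_measurable (D i)).mono (le_iSup₂_of_le i (hF i hi) le_rfl) le_rfl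
  have hind : IndepFun (fun ω (s : I) => ∑ i ∈ Finset.range (k s), D i ω)
      (fun ω (s : J) => ∑ i ∈ Finset.Ico m (l s), D i ω) μ := by
    refine indepFun_of_disjoint (hN.indep.nat hτ) hDm (A := Set.Iio m) (B := Set.Ici m)
      (Set.disjoint_left.2 fun i h1 h2 => not_lt.2 (Set.mem_Ici.1 h2) h1) ?_ ?_
    · exact @measurable_pi_lambda _ _ _ (_) _ _ fun s => hsum _ _ fun i hi =>
        (Finset.mem_range.1 hi).trans_le (hkm s)
    · exact @measurable_pi_lambda _ _ _ (_) _ _ fun s => hsum _ _ fun i hi =>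
        (Finset.mem_Ico.1 hi).1
  refine hind.congr ?_ ?_
  · filter_upwards [hN.ae_eq_sum hτ h0] with ω hω
    funext s
    rw [← hk s]
    exact (hω (k s)).symm
  · filter_upwards [hN.ae_eq_sum hτ h0] with ω hω
    funext s
    have e1 := hω (l s)
    have e2 := hω m
    rw [← Finset.sum_range_add_sum_Ico _ (hlm s), ← e2, hmt, hl s] at e1
    change ∑ i ∈ Finset.Ico m (l s), D i ω = _
    rw [e1, add_tsub_cancel_left]

theorem IsPoissonProcess.restart (hN : IsPoissonProcess μ N r) (t : ℝ≥0) :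
    IsPoissonProcess μ (fun s ω => N (t + s) ω - N t ω) r where
  zero := by simp
  mono := by
    filter_upwards [hN.mono] with ω hω a b hab
    exact tsub_le_tsub_right (hω (add_le_add_right hab t)) _
  indep := by
    intro n τ hτ
    have h := hN.indep n (fun i => t + τ i) fun i j hij => add_le_add_right (hτ hij) t
    refine h.congr fun i => ?_
    filter_upwards [hN.mono] with ω hω
    have := hω (le_add_right (le_refl t) : t ≤ t + τ i.castSucc)
    have := hω (add_le_add_right (hτ i.castSucc_le_succ) t)
    simp only at *
    omega
  law := by
    intro s s' hs
    have h := hN.law (t + s) (t + s') (add_le_add_right hs t)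
    rw [add_tsub_add_eq_tsub_left] at h
    refine h.congr ?_
    filter_upwards [hN.mono] with ω hω
    have := hω (le_add_right (le_refl t) : t ≤ t + s)
    have := hω (add_le_add_right hs t)
    simp only at *
    omega

end Poisson

/-! ### The Markov property of the clocks -/

variable {S : Type*}

theorem measurable_eval_clock (e : Edge S) (s : ℝ≥0) :
    Measurable fun K : Clocks S => (K e).1 s :=
  (measurable_pi_apply s).comp (measurable_subtype_coe.comp (measurable_pi_apply e))

theorem measurable_restart (t : ℝ≥0) : Measurable (restart t : Clocks S → Clocks S) :=
  measurable_pi_lambda _ fun e => (measurable_pi_lambda _ fun s =>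
    (measurable_eval_clock e (t + s)).sub (measurable_eval_clock e t)).subtype_mk

/-- The information carried by the clocks up to time `t`. -/
abbrev pastSigma (S : Type*) (t : ℝ≥0) : MeasurableSpace (Clocks S) :=
  ⨆ (e : Edge S) (s : Set.Iic t), MeasurableSpace.comap (fun K : Clocks S => (K e).1 s) ⊤

theorem measurable_eval_past {s t : ℝ≥0} (hst : s ≤ t) (e : Edge S) :
    Measurable[pastSigma S t] fun K : Clocks S => (K e).1 s :=
  (comap_measurable _).mono (le_iSup₂_of_le e (⟨s, hst⟩ : Set.Iic t) le_rfl) le_rfl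

theorem pastSigma_mono {s t : ℝ≥0} (hst : s ≤ t) : pastSigma S s ≤ pastSigma S t :=
  iSup₂_le fun e u => (measurable_eval_past (u.2.trans hst) e).comap_le

theorem pastSigma_le (t : ℝ≥0) : pastSigma S t ≤ (inferInstance : MeasurableSpace (Clocks S)) :=
  iSup₂_le fun e u => (measurable_eval_clock e u).comap_le

theorem iIndepFun_bool {Ω β : Type*} [MeasurableSpace Ω] [MeasurableSpace β] {μ : Measure Ω}
    [IsProbabilityMeasure μ] {X : Bool → Ω → β} (h : IndepFun (X false) (X true) μ) :
    iIndepFun X μ := by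
  rw [iIndepFun_iff_measure_inter_preimage_eq_mul]
  intro F sets hs
  have hF : F = ∅ ∨ F = {false} ∨ F = {true} ∨ F = {false, true} := by
    clear hs
    revert F
    decide
  rcases hF with rfl | rfl | rfl | rfl
  · simp
  · simp
  · simp
  · rw [Finset.prod_pair (by simp), Finset.set_biInter_insert, Finset.set_biInter_singleton]
    exact h.measure_inter_preimage_eq_mul _ _ (hs _ (by simp)) (hs _ (by simp))

section ClockLaw

variable {c : Edge S → ℝ≥0} {Pr : Measure (Clocks S)}

theorem IsPoissonClockLaw.indep_past_restart (hPr : IsPoissonClockLaw c Pr) (t : ℝ≥0) :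
    Indep (pastSigma S t) (MeasurableSpace.comap (restart t) inferInstance) Pr := by
  have := hPr.isProbabilityMeasure
  let X : Edge S → Bool → Clocks S → ℝ≥0 → ℕ := fun e b K =>
    if b then fun s => (K e).1 (t + s) - (K e).1 t else fun s => (K e).1 (min s t)
  have hX : ∀ e b, Measurable (X e b) := by
    intro e b
    cases b
    · exact measurable_pi_lambda _ fun s => measurable_eval_clock e _
    · exact measurable_pi_lambda _ fun s =>
        (measurable_eval_clock e (t + s)).sub (measurable_eval_clock e t)
  have h1 : iIndepFun (fun e K b => X e b K) Pr := by
    refine hPr.indep.comp (fun e (ζ : CadlagPath ℕ) (b : Bool) =>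
      if b then fun s => ζ.1 (t + s) - ζ.1 t else fun s => ζ.1 (min s t)) fun e => ?_
    have hev : ∀ s, Measurable fun ζ : CadlagPath ℕ => ζ.1 s := fun s =>
      (measurable_pi_apply s).comp measurable_subtype_coe
    refine measurable_pi_lambda _ fun b => ?_
    cases b
    · exact measurable_pi_lambda _ fun s => hev _
    · exact measurable_pi_lambda _ fun s => (hev _).sub (hev _)
  have h2 : ∀ e, iIndepFun (X e) Pr := fun e =>
    iIndepFun_bool ((hPr.poisson e).indepFun_past_future (measurable_eval_clock e) t)
  have h3 := indep_iSup_of_disjoint (fun p : Edge S × Bool => (hX p.1 p.2).comap_le)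
    (iIndepFun_uncurry' hX h1 h2).iIndep (S := {p | p.2 = false}) (T := {p | p.2 = true})
    (Set.disjoint_left.2 fun p hp hp' => by simp_all)
  refine indep_of_indep_of_le_left (indep_of_indep_of_le_right h3 ?_) ?_
  · refine Measurable.comap_le ?_
    refine @measurable_pi_lambda _ _ _ (_) _ _ fun e => Measurable.subtype_mk ?_
    refine Measurable.mono (comap_measurable (X e true)) ?_ le_rfl
    exact le_iSup₂_of_le (e, true) rfl le_rfl
  · refine iSup₂_le fun e s => Measurable.comap_le ?_
    have : (fun K : Clocks S => (K e).1 s) = (fun ζ : ℝ≥0 → ℕ => ζ s) ∘ X e false := by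
      funext K
      have hs : (s : ℝ≥0) ≤ t := s.2
      simp [X, hs]
    rw [this]
    refine Measurable.mono ((measurable_pi_apply _).comp (comap_measurable (X e false))) ?_ le_rfl
    exact le_iSup₂_of_le (e, false) rfl le_rfl

theorem path_measure_ext {P P' : Measure (CadlagPath ℕ)}
    (h : P.map Subtype.val = P'.map Subtype.val) : P = P' := by
  ext A hA
  obtain ⟨B, hB, rfl⟩ := hA
  rw [← Measure.map_apply measurable_subtype_coe hB, h,
    Measure.map_apply measurable_subtype_coe hB]

/-- The restarted clocks have the same law as the original ones. -/
theorem IsPoissonClockLaw.map_restart [Countable S] (hPr : IsPoissonClockLaw c Pr) (t : ℝ≥0) :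
    Pr.map (restart t) = Pr := by
  have := hPr.isProbabilityMeasure
  have hr : ∀ e, Measurable fun K : Clocks S => restart t K e := fun e =>
    (measurable_pi_apply e).comp (measurable_restart t)
  have hi : iIndepFun (fun e K => restart t K e) Pr := by
    refine hPr.indep.comp (fun _ (ζ : CadlagPath ℕ) =>
      (⟨fun s => ζ.1 (t + s) - ζ.1 t, isCadlag_restart ζ.2 t⟩ : CadlagPath ℕ)) fun e => ?_
    have hev : ∀ s, Measurable fun ζ : CadlagPath ℕ => ζ.1 s := fun s =>
      (measurable_pi_apply s).comp measurable_subtype_coe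
    exact (measurable_pi_lambda _ fun s => (hev _).sub (hev _)).subtype_mk
  have h := hPr.indep.map_fun_eq_infinitePi_map fun e => measurable_pi_apply e
  have h' := hi.map_fun_eq_infinitePi_map hr
  rw [show (fun (K : Clocks S) e => K e) = id from rfl, Measure.map_id] at h
  change Pr.map (restart t) = _ at h'
  rw [h']
  conv_rhs => rw [h]
  congr 1
  funext e
  have := Measure.isProbabilityMeasure_map (μ := Pr) (hr e).aemeasurable
  refine path_measure_ext ?_
  rw [Measure.map_map measurable_subtype_coe (hr e),
    Measure.map_map measurable_subtype_coe (measurable_pi_apply e)]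
  exact ((hPr.poisson e).restart t).map_eq (hPr.poisson e)
    (fun s => (measurable_eval_clock e (t + s)).sub (measurable_eval_clock e t))
    (measurable_eval_clock e)

end ClockLaw

end

section

/-! ### Small time estimates for Poisson processes -/

theorem poissonMeasure_zero (l : ℝ≥0) :
    poissonMeasure l {0} = ENNReal.ofReal (Real.exp (-l)) := by
  rw [poissonMeasure_singleton]; simp

theorem poissonMeasure_one (l : ℝ≥0) :
    poissonMeasure l {1} = ENNReal.ofReal (l * Real.exp (-l)) := by
  rw [poissonMeasure_singleton]; simp [mul_comm]

theorem poissonMeasure_ne_zero_le (l : ℝ≥0) : poissonMeasure l {0}ᶜ ≤ l := by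
  rw [prob_compl_eq_one_sub (measurableSet_singleton 0), poissonMeasure_zero,
    ← ENNReal.ofReal_one, ← ENNReal.ofReal_sub _ (Real.exp_pos _).le, ← ENNReal.ofReal_coe_nnreal]
  refine ENNReal.ofReal_le_ofReal ?_
  have := Real.add_one_le_exp (-(l : ℝ))
  linarith

theorem poissonMeasure_two_le (l : ℝ≥0) :
    poissonMeasure l {n | 2 ≤ n} ≤ (l : ℝ≥0∞) * l := by
  have hset : {n : ℕ | 2 ≤ n} = ({0} ∪ {1})ᶜ := by
    ext n
    simp only [Set.mem_ofPred_eq, Set.mem_compl_iff, Set.mem_union, Set.mem_singleton_iff]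
    omega
  have h1 := Real.add_one_le_exp (-(l : ℝ))
  rw [hset, prob_compl_eq_one_sub (by measurability),
    measure_union (by simp) (measurableSet_singleton 1), poissonMeasure_zero, poissonMeasure_one,
    ← ENNReal.ofReal_add (by positivity) (by positivity),
    ← ENNReal.ofReal_one, ← ENNReal.ofReal_sub _ (by positivity), ← ENNReal.ofReal_coe_nnreal,
    ← ENNReal.ofReal_mul (by positivity)]
  refine ENNReal.ofReal_le_ofReal ?_
  have h2 : (0 : ℝ) ≤ l := l.2
  nlinarith

/-- The cell `(j / (n + 1), (j + 1) / (n + 1)]` of the grid containing a given time. -/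
theorem exists_grid_cell {u : ℝ≥0} (hu : 0 < u) {T : ℕ} (huT : u ≤ T) (n : ℕ) :
    ∃ j < T * (n + 1), (j : ℝ≥0) / (n + 1) < u ∧ u ≤ (j + 1 : ℕ) / (n + 1) := by
  have hn : (0 : ℝ≥0) < n + 1 := by positivity
  have h0 : 0 < u * (n + 1) := by positivity
  have hc : 0 < ⌈u * (n + 1)⌉₊ := Nat.ceil_pos.2 h0
  have h1 : ⌈u * (n + 1)⌉₊ ≤ T * (n + 1) := by
    refine Nat.ceil_le.2 ?_
    push_cast
    gcongr
  refine ⟨⌈u * (n + 1)⌉₊ - 1, by omega, ?_, ?_⟩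
  · rw [div_lt_iff₀ hn]
    exact Nat.lt_ceil.1 (by omega)
  · rw [le_div_iff₀ hn, Nat.sub_add_cancel hc]
    exact Nat.le_ceil _

/-- A set that is covered, for each `n`, by `T (n + 1)` sets of measure `O(1 / n ^ 2)` is null. -/
theorem measure_zero_of_grid_cover {Ω : Type*} [MeasurableSpace Ω] {μ : Measure Ω} {A : Set Ω}
    (T : ℕ) (C : ℝ≥0) (B : ℕ → ℕ → Set Ω)
    (hB : ∀ n j, μ (B n j) ≤ ((C / ((n + 1) * (n + 1)) : ℝ≥0) : ℝ≥0∞))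
    (hA : ∀ n, A ⊆ ⋃ j ∈ Finset.range (T * (n + 1)), B n j) : μ A = 0 := by
  have hle : ∀ n : ℕ, μ A ≤ ((T * C / (n + 1) : ℝ≥0) : ℝ≥0∞) := fun n => by
    refine (measure_mono (hA n)).trans ((measure_biUnion_finset_le _ _).trans ?_)
    refine (Finset.sum_le_sum fun j _ => hB n j).trans ?_
    rw [Finset.sum_const, Finset.card_range, nsmul_eq_mul]
    have hn : (n + 1 : ℝ≥0) ≠ 0 := by positivity
    have : (T * C / (n + 1) : ℝ≥0) = ((T * (n + 1) : ℕ) : ℝ≥0) * (C / ((n + 1) * (n + 1))) := by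
      push_cast
      field_simp
    rw [this]
    push_cast
    exact le_rfl
  have hlim : Tendsto (fun n : ℕ => ((T * C / (n + 1) : ℝ≥0) : ℝ≥0∞)) atTop (𝓝 0) := by
    rw [← ENNReal.coe_zero, ENNReal.tendsto_coe]
    refine NNReal.tendsto_coe.1 ?_
    have := (tendsto_one_div_add_atTop_nhds_zero_nat (𝕜 := ℝ)).const_mul ((T : ℝ) * C)
    rw [mul_zero] at this
    refine this.congr fun n => ?_
    push_cast
    ring
  exact le_antisymm (ge_of_tendsto' hlim hle) zero_le

variable {S : Type*} {c : Edge S → ℝ≥0} {Pr : Measure (Clocks S)}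

instance [Countable S] : Countable (Edge S) :=
  have : Countable (Sym2 S) := inferInstanceAs (Countable (Quot _))
  inferInstance

namespace IsPoissonClockLaw

theorem measure_increment (hPr : IsPoissonClockLaw c Pr) (e : Edge S) {s t : ℝ≥0} (hst : s ≤ t)
    (A : Set ℕ) :
    Pr {K | (K e).1 t - (K e).1 s ∈ A} = poissonMeasure (c e * (t - s)) A := by
  have hm : Measurable fun K : Clocks S => (K e).1 t - (K e).1 s :=
    (measurable_eval_clock e t).sub (measurable_eval_clock e s)
  rw [← ((hPr.poisson e).law s t hst).map_eq, Measure.map_apply hm MeasurableSet.of_discrete]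
  rfl

theorem measure_increment_grid (hPr : IsPoissonClockLaw c Pr) (e : Edge S) (n j : ℕ) (A : Set ℕ) :
    Pr {K | (K e).1 ((j + 1 : ℕ) / (n + 1)) - (K e).1 (j / (n + 1)) ∈ A} =
      poissonMeasure (c e / (n + 1)) A := by
  have hle : (j : ℝ≥0) / (n + 1) ≤ (j + 1 : ℕ) / (n + 1) := by
    push_cast
    gcongr
    exact le_add_right le_rfl
  rw [hPr.measure_increment e hle]
  congr 2
  rw [← tsub_div]
  push_cast
  rw [add_tsub_cancel_left, mul_one_div]

/-- A jump of size at least `2` forces an increment of size at least `2` over a cell of each grid,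
an event of probability `O(1 / n ^ 2)`. -/
theorem ae_unitJumps (hPr : IsPoissonClockLaw c Pr) (e : Edge S) :
    ∀ᵐ K ∂Pr, UnitJumps (K e).1 := by
  have hnull : ∀ T : ℕ, ∀ᵐ K ∂Pr, ¬ (Monotone (K e).1 ∧ ∃ u ∈ jumpTimes (K e).1, u ≤ T ∧
      (K e).1 u ≠ Function.leftLim (K e).1 u + 1) := by
    intro T
    rw [ae_iff]
    refine measure_zero_of_grid_cover T (c e * c e)
      (fun n j => {K | (K e).1 ((j + 1 : ℕ) / (n + 1)) - (K e).1 (j / (n + 1)) ∈ {n | 2 ≤ n}})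
      (fun n j => ?_) fun n K hK => ?_
    · rw [hPr.measure_increment_grid]
      refine (poissonMeasure_two_le _).trans (le_of_eq ?_)
      rw [← ENNReal.coe_mul, div_mul_div_comm]
    · obtain ⟨hm, u, hu, huT, hne⟩ := not_not.1 hK
      obtain ⟨j, hj, h1, h2⟩ := exists_grid_cell (pos_of_mem_jumpTimes hu) huT n
      refine Set.mem_biUnion (Finset.mem_coe.2 (Finset.mem_range.2 hj)) ?_
      have a1 := hm.le_leftLim h1
      have a2 := hm h2
      have a3 := hm.leftLim_le (le_refl u)
      have a4 : Function.leftLim (K e).1 u ≠ (K e).1 u := hu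
      simp only [Set.mem_ofPred_eq]
      omega
  filter_upwards [(hPr.poisson e).mono, ae_all_iff.2 hnull] with K hm h u hu
  by_contra hne
  obtain ⟨T, hT⟩ := exists_nat_ge u
  exact h T ⟨hm, u, hu, hT, hne⟩

/-- A common jump time forces two independent clocks to ring in the same cell of each grid, an event
of probability `O(1 / n ^ 2)`. -/
theorem ae_disjoint (hPr : IsPoissonClockLaw c Pr) {e e' : Edge S} (hee : e ≠ e') :
    ∀ᵐ K ∂Pr, Disjoint (jumpTimes (K e).1) (jumpTimes (K e').1) := by
  have hnull : ∀ T : ℕ, ∀ᵐ K ∂Pr, ¬ (Monotone (K e).1 ∧ Monotone (K e').1 ∧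
      ∃ u ∈ jumpTimes (K e).1, u ∈ jumpTimes (K e').1 ∧ u ≤ T) := by
    intro T
    rw [ae_iff]
    refine measure_zero_of_grid_cover T (c e * c e')
      (fun n j => {K | (K e).1 ((j + 1 : ℕ) / (n + 1)) - (K e).1 (j / (n + 1)) ∈ ({0}ᶜ : Set ℕ)} ∩
        {K | (K e').1 ((j + 1 : ℕ) / (n + 1)) - (K e').1 (j / (n + 1)) ∈ ({0}ᶜ : Set ℕ)})
      (fun n j => ?_) fun n K hK => ?_
    · have hev : ∀ s, Measurable fun ζ : CadlagPath ℕ => ζ.1 s := fun s =>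
        (measurable_pi_apply s).comp measurable_subtype_coe
      have hg : Measurable fun ζ : CadlagPath ℕ =>
        ζ.1 ((j + 1 : ℕ) / (n + 1)) - ζ.1 (j / (n + 1)) := (hev _).sub (hev _)
      have hmul := ((hPr.indep.indepFun hee).comp hg hg).measure_inter_preimage_eq_mul
        ({0}ᶜ : Set ℕ) ({0}ᶜ : Set ℕ) MeasurableSet.of_discrete MeasurableSet.of_discrete
      refine (le_of_eq hmul).trans ?_
      have h1 := hPr.measure_increment_grid e n j {0}ᶜ
      have h2 := hPr.measure_increment_grid e' n j {0}ᶜ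
      calc _ = poissonMeasure (c e / (n + 1)) {0}ᶜ * poissonMeasure (c e' / (n + 1)) {0}ᶜ := by
            rw [← h1, ← h2]; rfl
        _ ≤ ((c e / (n + 1) : ℝ≥0) : ℝ≥0∞) * ((c e' / (n + 1) : ℝ≥0) : ℝ≥0∞) :=
            mul_le_mul' (poissonMeasure_ne_zero_le _) (poissonMeasure_ne_zero_le _)
        _ = _ := by rw [← ENNReal.coe_mul, div_mul_div_comm]
    · obtain ⟨hm, hm', u, hu, hu', huT⟩ := not_not.1 hK
      obtain ⟨j, hj, h1, h2⟩ := exists_grid_cell (pos_of_mem_jumpTimes hu) huT n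
      refine Set.mem_biUnion (Finset.mem_coe.2 (Finset.mem_range.2 hj)) ?_
      have a1 := lt_of_mem_jumpTimes hm h1 hu
      have a2 := hm h2
      have a3 := lt_of_mem_jumpTimes hm' h1 hu'
      have a4 := hm' h2
      simp only [Set.mem_inter_iff, Set.mem_ofPred_eq, Set.mem_compl_iff, Set.mem_singleton_iff]
      omega
  filter_upwards [(hPr.poisson e).mono, (hPr.poisson e').mono, ae_all_iff.2 hnull] with K hm hm' h
  refine Set.disjoint_left.2 fun u hu hu' => ?_
  obtain ⟨T, hT⟩ := exists_nat_ge u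
  exact h T ⟨hm, hm', u, hu, hu', hT⟩

end IsPoissonClockLaw

theorem exitRate_eq_tsum_star (c : Edge S → ℝ≥0) (x : S) :
    exitRate c x = ∑' e : star x, (c e : ℝ≥0∞) := by
  have hbij : Function.Bijective
      (fun y : {y // x ≠ y} => (⟨edge y.2, edge_mem_star y.2⟩ : star x)) := by
    refine ⟨fun y z h => edge_injective x (congrArg Subtype.val h), fun e => ?_⟩
    obtain ⟨y, h, he⟩ := exists_edge_of_mem_star e.2
    exact ⟨⟨y, h⟩, Subtype.ext he.symm⟩
  rw [← (Equiv.ofBijective _ hbij).tsum_eq]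
  have h1 : ∑' y : {y // x ≠ y}, (rate c x y : ℝ≥0∞) = ∑' y, (rate c x y : ℝ≥0∞) := by
    refine tsum_subtype_eq_of_support_subset (f := fun y => (rate c x y : ℝ≥0∞))
      (s := {y | x ≠ y}) fun y hy => ?_
    by_contra hxy
    refine hy ?_
    simp only [Set.mem_ofPred_eq] at hxy
    simp [rate, hxy]
  rw [exitRate, ← h1]
  refine tsum_congr fun y => ?_
  simp [rate, y.2]

/-- The total rate at `x`, as a nonnegative real number. It is used only where it is finite. -/
noncomputable def totalRate (c : Edge S → ℝ≥0) (x : S) : ℝ≥0 := (exitRate c x).toNNReal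

theorem sum_le_totalRate {x : S} (hx : exitRate c x ≠ ∞) {F : Finset (Edge S)}
    (hF : ∀ e ∈ F, e ∈ star x) : ∑ e ∈ F, c e ≤ totalRate c x := by
  rw [← ENNReal.coe_le_coe, totalRate, ENNReal.coe_toNNReal hx, exitRate_eq_tsum_star]
  have : ∑' e : star x, (c e : ℝ≥0∞) = ∑' e, (star x).indicator (fun e => (c e : ℝ≥0∞)) e :=
    tsum_subtype (star x) fun e => (c e : ℝ≥0∞)
  rw [this]
  push_cast
  refine le_trans (le_of_eq ?_) (ENNReal.sum_le_tsum F)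
  exact Finset.sum_congr rfl fun e he =>
    (Set.indicator_of_mem (hF e he) fun e => (c e : ℝ≥0∞)).symm

theorem IsPoissonClockLaw.ae_finite [Countable S] (hPr : IsPoissonClockLaw c Pr) {x : S}
    (hx : exitRate c x ≠ ∞) :
    ∀ᵐ K ∂Pr, ∀ T : ℕ, {e : star x | (K e).1 T - (K e).1 0 ∈ ({0}ᶜ : Set ℕ)}.Finite := by
  refine ae_all_iff.2 fun T => ?_
  refine ae_finite_setOfPred_mem (s := fun e : star x =>
    {K : Clocks S | (K e).1 T - (K e).1 0 ∈ ({0}ᶜ : Set ℕ)}) (ne_top_of_le_ne_top ?_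
    (ENNReal.tsum_le_tsum (g := fun e : star x => (c e : ℝ≥0∞) * T)
    fun e : star x => ?_))
  · rw [ENNReal.tsum_mul_right, ← exitRate_eq_tsum_star]
    exact ENNReal.mul_ne_top hx (ENNReal.natCast_ne_top T)
  · rw [hPr.measure_increment e zero_le]
    refine (poissonMeasure_ne_zero_le _).trans (le_of_eq ?_)
    simp

/-- Almost every realization of the clocks is regular. -/
theorem IsPoissonClockLaw.ae_regular [Countable S] (hPr : IsPoissonClockLaw c Pr)
    (hc : ∀ x, exitRate c x ≠ ∞) : ∀ᵐ K ∂Pr, Regular K := by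
  have h1 := ae_all_iff.2 fun e => (hPr.poisson e).zero
  have h2 := ae_all_iff.2 fun e => (hPr.poisson e).mono
  have h3 := ae_all_iff.2 hPr.ae_unitJumps
  have h4 : ∀ᵐ K ∂Pr, ∀ e e' : Edge S, e ≠ e' →
      Disjoint (jumpTimes (K e).1) (jumpTimes (K e').1) := by
    refine ae_all_iff.2 fun e => ae_all_iff.2 fun e' => ?_
    by_cases hee : e = e'
    · exact Eventually.of_forall fun K h => absurd hee h
    · filter_upwards [hPr.ae_disjoint hee] with K hK _ using hK
  have h5 := ae_all_iff.2 fun x => hPr.ae_finite (hc x)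
  filter_upwards [h1, h2, h3, h4, h5] with K h1 h2 h3 h4 h5
  refine ⟨h2, h3, h4, fun x t => ?_⟩
  obtain ⟨T, hT⟩ := exists_nat_ge t
  refine ((h5 x T).image Subtype.val).subset ?_
  rintro e ⟨he, hne⟩
  refine ⟨⟨e, he⟩, ?_, rfl⟩
  have a1 := h1 e
  have a2 : (K e).1 t ≤ (K e).1 T := h2 e hT
  simp only [Set.mem_ofPred_eq, Set.mem_compl_iff, Set.mem_singleton_iff]
  omega

/-! ### Probabilities of quiet intervals and of single rings -/

theorem measurableSet_quiet [Countable S] (B : Set (Edge S)) (q r : ℝ≥0) :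
    MeasurableSet {K : Clocks S | Quiet K B q r} := by
  simp only [Quiet, Set.ofPred_forall]
  exact MeasurableSet.iInter fun e => MeasurableSet.iInter fun _ =>
    measurableSet_eq_fun (measurable_eval_clock e q) (measurable_eval_clock e r)

theorem measurableSet_singleRing [Countable S] {x y : S} (h : x ≠ y) (q r : ℝ≥0) :
    MeasurableSet {K : Clocks S | SingleRing K h q r} :=
  (measurableSet_eq_fun (measurable_eval_clock _ r)
    ((measurable_eval_clock _ q).add_const 1)).inter (measurableSet_quiet _ q r)

theorem Quiet.of_restart {K : Clocks S} (hK : ∀ e, Monotone (K e).1) {B : Set (Edge S)} {t h : ℝ≥0}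
    (hq : Quiet (restart t K) B 0 h) : Quiet K B t (t + h) := by
  intro e he
  have h1 := hq e he
  have h2 := hK e (le_add_right (le_refl t) : t ≤ t + h)
  simp only [restart, add_zero] at h1
  omega

theorem SingleRing.of_restart {K : Clocks S} (hK : ∀ e, Monotone (K e).1) {x y : S} {hxy : x ≠ y}
    {t h : ℝ≥0} (hq : SingleRing (restart t K) hxy 0 h) : SingleRing K hxy t (t + h) := by
  refine ⟨?_, Quiet.of_restart hK hq.2⟩
  have h1 := hq.1
  have h2 := hK (edge hxy) (le_add_right (le_refl t) : t ≤ t + h)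
  simp only [restart, add_zero] at h1
  omega

namespace IsPoissonClockLaw

theorem le_measure_increments [Countable S] (hPr : IsPoissonClockLaw c Pr) (h : ℝ≥0)
    (T : Edge S → Set ℕ) {a : ℝ≥0∞}
    (ha : ∀ F : Finset (Edge S), a ≤ ∏ e ∈ F, poissonMeasure (c e * h) (T e)) :
    a ≤ Pr {K | ∀ e, (K e).1 h - (K e).1 0 ∈ T e} := by
  have := hPr.isProbabilityMeasure
  have hev : ∀ s, Measurable fun ζ : CadlagPath ℕ => ζ.1 s := fun s =>
    (measurable_pi_apply s).comp measurable_subtype_coe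
  have hind := hPr.indep.comp (fun _ ζ => ζ.1 h - ζ.1 0) fun _ => (hev h).sub (hev 0)
  have hm : ∀ e, MeasurableSet {K : Clocks S | (K e).1 h - (K e).1 0 ∈ T e} := fun e =>
    ((measurable_eval_clock e h).sub (measurable_eval_clock e 0)) MeasurableSet.of_discrete
  have hF : ∀ F : Finset (Edge S), a ≤ Pr (⋂ e ∈ F, {K | (K e).1 h - (K e).1 0 ∈ T e}) := by
    intro F
    refine (ha F).trans (le_of_eq ?_)
    refine Eq.trans ?_ (hind.measure_inter_preimage_eq_mul F (sets := T)
      fun _ _ => MeasurableSet.of_discrete).symm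
    refine Finset.prod_congr rfl fun e _ => ?_
    have := hPr.measure_increment e (zero_le (a := h)) (T e)
    rw [tsub_zero] at this
    exact this.symm
  have hlim := tendsto_measure_iInter_atTop (μ := Pr)
    (s := fun F : Finset (Edge S) => ⋂ e ∈ F, {K : Clocks S | (K e).1 h - (K e).1 0 ∈ T e})
    (fun F => (F.measurableSet_biInter fun e _ => hm e).nullMeasurableSet)
    (fun F G hFG => Set.biInter_subset_biInter_left hFG) ⟨∅, measure_ne_top _ _⟩
  refine (ge_of_tendsto' hlim hF).trans (measure_mono fun K hK e => ?_)
  have := Set.mem_iInter.1 hK {e}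
  simpa using this

theorem le_measure_quiet [Countable S] (hPr : IsPoissonClockLaw c Pr) {B : Set (Edge S)} {C : ℝ≥0}
    (hB : ∀ F : Finset (Edge S), (∀ e ∈ F, e ∈ B) → ∑ e ∈ F, c e ≤ C) (h : ℝ≥0) :
    ENNReal.ofReal (Real.exp (-(C * h))) ≤ Pr {K | Quiet K B 0 h} := by
  classical
  refine (hPr.le_measure_increments h (fun e => if e ∈ B then {0} else Set.univ)
    fun F => ?_).trans (measure_mono_ae ?_)
  · have : ∏ e ∈ F, poissonMeasure (c e * h) (if e ∈ B then {0} else Set.univ) =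
        ∏ e ∈ F with e ∈ B, ENNReal.ofReal (Real.exp (-(c e * h))) := by
      rw [Finset.prod_filter]
      refine Finset.prod_congr rfl fun e _ => ?_
      split_ifs
      · rw [poissonMeasure_zero]; simp
      · exact measure_univ
    rw [this, ← ENNReal.ofReal_prod_of_nonneg fun e _ => (Real.exp_pos _).le, ← Real.exp_sum]
    refine ENNReal.ofReal_le_ofReal (Real.exp_le_exp.2 ?_)
    rw [Finset.sum_neg_distrib, ← Finset.sum_mul]
    have h1 := hB (F.filter (· ∈ B)) fun e he => (Finset.mem_filter.1 he).2
    have h2 : (∑ e ∈ F with e ∈ B, (c e : ℝ)) ≤ C := by exact_mod_cast h1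
    have h3 := mul_le_mul_of_nonneg_right h2 h.2
    simpa using h3
  · filter_upwards [ae_all_iff.2 fun e => (hPr.poisson e).mono] with K hm hK e he
    have h1 := hK e
    have h2 : (K e).1 0 ≤ (K e).1 h := hm e zero_le
    simp only [if_pos he, Set.mem_singleton_iff] at h1
    omega

theorem le_measure_ring_quiet [Countable S] (hPr : IsPoissonClockLaw c Pr) {B : Set (Edge S)}
    {C : ℝ≥0} {e₀ : Edge S} (he₀ : e₀ ∉ B)
    (hB : ∀ F : Finset (Edge S), (∀ e ∈ F, e ∈ B) → c e₀ + ∑ e ∈ F, c e ≤ C) (h : ℝ≥0) :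
    ENNReal.ofReal (c e₀ * h * Real.exp (-(C * h))) ≤
      Pr {K | (K e₀).1 h = (K e₀).1 0 + 1 ∧ Quiet K B 0 h} := by
  classical
  let T : Edge S → Set ℕ := fun e => if e = e₀ then {1} else if e ∈ B then {0} else Set.univ
  refine (hPr.le_measure_increments h T fun F => ?_).trans (measure_mono_ae ?_)
  · have hle : ∏ e ∈ insert e₀ F, poissonMeasure (c e * h) (T e) ≤
        ∏ e ∈ F, poissonMeasure (c e * h) (T e) :=
      Finset.prod_le_prod_of_subset_of_le_one' (Finset.subset_insert _ _) fun _ _ _ => prob_le_one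
    refine le_trans ?_ hle
    rw [← Finset.insert_erase (Finset.mem_insert_self e₀ F), Finset.prod_insert (by simp)]
    set G := (insert e₀ F).erase e₀
    have hG : ∀ e ∈ G, e ≠ e₀ := fun e he => Finset.ne_of_mem_erase he
    have : ∏ e ∈ G, poissonMeasure (c e * h) (T e) =
        ∏ e ∈ G with e ∈ B, ENNReal.ofReal (Real.exp (-(c e * h))) := by
      rw [Finset.prod_filter]
      refine Finset.prod_congr rfl fun e he => ?_
      simp only [T, if_neg (hG e he)]
      split_ifs
      · rw [poissonMeasure_zero]; simp
      · exact measure_univ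
    rw [this, ← ENNReal.ofReal_prod_of_nonneg fun e _ => (Real.exp_pos _).le, ← Real.exp_sum]
    simp only [T, if_true]
    rw [poissonMeasure_one, ← ENNReal.ofReal_mul (by positivity)]
    refine ENNReal.ofReal_le_ofReal ?_
    push_cast
    rw [mul_assoc (_ * _) (Real.exp _), ← Real.exp_add]
    refine mul_le_mul_of_nonneg_left (Real.exp_le_exp.2 ?_) (by positivity)
    rw [Finset.sum_neg_distrib, ← Finset.sum_mul]
    have h1 := hB (G.filter (· ∈ B)) fun e he => (Finset.mem_filter.1 he).2
    have h2 : (c e₀ : ℝ) + (∑ e ∈ G with e ∈ B, (c e : ℝ)) ≤ C := by exact_mod_cast h1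
    have h3 := mul_le_mul_of_nonneg_right h2 h.2
    have h4 : ((h.1 : ℝ)) = (h : ℝ) := rfl
    rw [h4] at h3
    linarith
  · filter_upwards [ae_all_iff.2 fun e => (hPr.poisson e).mono] with K hm hK
    refine ⟨?_, fun e he => ?_⟩
    · have h1 := hK e₀
      simp only [T, if_true, Set.mem_singleton_iff] at h1
      omega
    · have h1 := hK e
      have h2 : (K e).1 0 ≤ (K e).1 h := hm e zero_le
      have h3 : e ≠ e₀ := fun h => he₀ (h ▸ he)
      simp only [T, if_pos he, if_neg h3, Set.mem_singleton_iff] at h1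
      omega

theorem measure_inter_restart [Countable S] (hPr : IsPoissonClockLaw c Pr) (t : ℝ≥0)
    {A E : Set (Clocks S)} (hA : MeasurableSet[pastSigma S t] A) (hE : MeasurableSet E) :
    Pr (A ∩ restart t ⁻¹' E) = Pr A * Pr E := by
  rw [(Indep_iff _ _ _).1 (hPr.indep_past_restart t) _ _ hA ⟨E, hE, rfl⟩,
    ← Measure.map_apply (measurable_restart t) hE, hPr.map_restart]

theorem le_measure_inter_quiet [Countable S] (hPr : IsPoissonClockLaw c Pr) {x : S}
    (hx : exitRate c x ≠ ∞) {t : ℝ≥0} (h : ℝ≥0) {A : Set (Clocks S)}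
    (hA : MeasurableSet[pastSigma S t] A) :
    Pr A * ENNReal.ofReal (Real.exp (-(totalRate c x * h))) ≤
      Pr (A ∩ {K | Quiet K (star x) t (t + h)}) := by
  calc _ ≤ Pr A * Pr {K | Quiet K (star x) 0 h} :=
        mul_le_mul_right (hPr.le_measure_quiet (fun F hF => sum_le_totalRate hx hF) h) _
    _ = Pr (A ∩ restart t ⁻¹' {K | Quiet K (star x) 0 h}) :=
        (hPr.measure_inter_restart t hA (measurableSet_quiet _ _ _)).symm
    _ ≤ _ := measure_mono_ae <| by
        filter_upwards [ae_all_iff.2 fun e => (hPr.poisson e).mono] with K hm hK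
        exact ⟨hK.1, Quiet.of_restart hm hK.2⟩

theorem le_measure_inter_singleRing [Countable S] (hPr : IsPoissonClockLaw c Pr) {x y : S}
    (hxy : x ≠ y) (hx : exitRate c x ≠ ∞) (hy : exitRate c y ≠ ∞) {t : ℝ≥0} (h : ℝ≥0)
    {A : Set (Clocks S)} (hA : MeasurableSet[pastSigma S t] A) :
    Pr A * ENNReal.ofReal
        (c (edge hxy) * h * Real.exp (-((totalRate c x + totalRate c y : ℝ≥0) * h))) ≤
      Pr (A ∩ {K | SingleRing K hxy t (t + h)}) := by
  classical
  have hB : ∀ F : Finset (Edge S), (∀ e ∈ F, e ∈ (star x ∪ star y) \ {edge hxy}) →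
      c (edge hxy) + ∑ e ∈ F, c e ≤ totalRate c x + totalRate c y := by
    intro F hF
    rw [← Finset.sum_filter_add_sum_filter_not F (· ∈ star x), ← add_assoc]
    refine add_le_add ?_ (sum_le_totalRate hy fun e he => ?_)
    · rw [← Finset.sum_insert (fun h => (hF _ (Finset.mem_filter.1 h).1).2 rfl)]
      refine sum_le_totalRate hx fun e he => ?_
      rcases Finset.mem_insert.1 he with rfl | he
      · exact edge_mem_star hxy
      · exact (Finset.mem_filter.1 he).2
    · obtain ⟨h1, h2⟩ := Finset.mem_filter.1 he
      exact (hF e h1).1.resolve_left h2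
  calc _ ≤ Pr A * Pr {K | SingleRing K hxy 0 h} :=
        mul_le_mul_right (hPr.le_measure_ring_quiet (fun h => h.2 rfl) hB h) _
    _ = Pr (A ∩ restart t ⁻¹' {K | SingleRing K hxy 0 h}) :=
        (hPr.measure_inter_restart t hA (measurableSet_singleRing _ _ _)).symm
    _ ≤ _ := measure_mono_ae <| by
        filter_upwards [ae_all_iff.2 fun e => (hPr.poisson e).mono] with K hm hK
        exact ⟨hK.1, SingleRing.of_restart hm hK.2⟩

end IsPoissonClockLaw

end

/-! ### The random walk: first step decomposition -/

section Walk

instance : IsProbabilityMeasure (expMeasure 1) := isProbabilityMeasure_expMeasure one_pos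

/-- The sequence `a, f 0, f 1, …`. -/
def seqCons {α : Type*} (a : α) (f : ℕ → α) : ℕ → α
  | 0 => a
  | n + 1 => f n

theorem measurable_seqCons {α β : Type*} [MeasurableSpace α] [MeasurableSpace β] {f : β → α}
    {g : β → ℕ → α} (hf : Measurable f) (hg : Measurable g) :
    Measurable fun b => seqCons (f b) (g b) := by
  refine measurable_pi_lambda _ fun n => ?_
  cases n with
  | zero => exact hf
  | succ n => exact (measurable_pi_apply n).comp hg

/-- The first term of an i.i.d. sequence is independent of the others, which again form an i.i.d.
sequence. -/
theorem map_seqCons_infinitePi {α : Type*} [MeasurableSpace α] (P : Measure α)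
    [IsProbabilityMeasure P] :
    (P.prod (Measure.infinitePi fun _ : ℕ => P)).map (fun p => seqCons p.1 p.2) =
      Measure.infinitePi fun _ : ℕ => P := by
  classical
  refine Measure.eq_infinitePi _ fun s t ht => ?_
  have hm : Measurable fun p : α × (ℕ → α) => seqCons p.1 p.2 :=
    measurable_seqCons measurable_fst measurable_snd
  -- enlarge the finite set of coordinates to an initial segment
  let t' : ℕ → Set α := fun i => if i ∈ s then t i else Set.univ
  have ht' : ∀ i, MeasurableSet (t' i) := fun i => by
    simp only [t']; split_ifs
    · exact ht i
    · exact MeasurableSet.univ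
  obtain ⟨m, hsm⟩ : ∃ m, s ⊆ Finset.range (m + 1) :=
    ⟨s.sup id, fun i hi => Finset.mem_range.2 (Nat.lt_succ_of_le (Finset.le_sup (f := id) hi))⟩
  have hpi : (s : Set ℕ).pi t = (Finset.range (m + 1) : Set ℕ).pi t' := by
    ext f
    simp only [Set.mem_pi, Finset.mem_coe, t']
    refine ⟨fun h i _ => ?_, fun h i hi => ?_⟩
    · split_ifs with hi
      · exact h i hi
      · exact Set.mem_univ _
    · have := h i (hsm hi)
      rwa [if_pos hi] at this
  have hprod : ∏ i ∈ s, P (t i) = ∏ i ∈ Finset.range (m + 1), P (t' i) := by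
    rw [← Finset.prod_subset hsm fun i _ hi => by simp [t', hi]]
    exact Finset.prod_congr rfl fun i hi => by simp [t', hi]
  rw [hpi, hprod, Measure.map_apply hm (.pi (Finset.countable_toSet _) fun i _ => ht' i)]
  have hset : (fun p : α × (ℕ → α) => seqCons p.1 p.2) ⁻¹'
      (Finset.range (m + 1) : Set ℕ).pi t' =
        t' 0 ×ˢ (Finset.range m : Set ℕ).pi fun i => t' (i + 1) := by
    ext ⟨a, f⟩
    simp only [Set.mem_preimage, Set.mem_pi, Finset.mem_coe, Finset.mem_range, Set.mem_prod]
    refine ⟨fun h => ⟨h 0 m.succ_pos, fun i hi => h (i + 1) (by omega)⟩, fun h i hi => ?_⟩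
    cases i with
    | zero => exact h.1
    | succ i => exact h.2 i (by omega)
  rw [hset, Measure.prod_prod, Measure.infinitePi_pi _ fun i _ => ht' (i + 1),
    Finset.prod_range_succ', mul_comm]

variable {S : Type*}

/-- The sequences that begin with `a 0, …, a n`. -/
def initialCylinder (n : ℕ) (a : ℕ → S) : Set (ℕ → S) := {Y | ∀ i ≤ n, Y i = a i}

theorem measurableSet_initialCylinder [MeasurableSpace S] [DiscreteMeasurableSpace S] (n : ℕ)
    (a : ℕ → S) : MeasurableSet (initialCylinder n a) := by
  simp only [initialCylinder, Set.ofPred_forall]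
  exact MeasurableSet.iInter fun i => MeasurableSet.iInter fun _ =>
    show MeasurableSet ((fun Y : ℕ → S => Y i) ⁻¹' {a i}) from
      measurable_pi_apply i (measurableSet_singleton (a i))

/-- The time of the `n`-th jump of the walk, the sum of its first `n` waiting times. -/
noncomputable def jumpTime (c : Edge S → ℝ≥0) (n : ℕ) (w : (ℕ → S) × (ℕ → ℝ)) : ℝ≥0∞ :=
  ∑ i ∈ Finset.range n, ENNReal.ofReal (w.2 i) / exitRate c (w.1 i)

theorem measurable_jumpTime [MeasurableSpace S] [DiscreteMeasurableSpace S] (c : Edge S → ℝ≥0)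
    (n : ℕ) : Measurable (jumpTime c n) := by
  refine Finset.measurable_sum _ fun i _ => Measurable.div ?_ ?_
  · exact ENNReal.measurable_ofReal.comp ((measurable_pi_apply i).comp measurable_snd)
  · exact (Measurable.of_discrete (f := exitRate c)).comp
      ((measurable_pi_apply i).comp measurable_fst)

theorem exitRate_mul_jumpLaw_le (c : Edge S → ℝ≥0) {x : S} (hx : exitRate c x ≠ ∞)
    (y : S) :
    exitRate c x * jumpLaw c x y ≤ rate c x y := by
  by_cases h0 : exitRate c x = 0
  · simp [h0]
  · have h : jumpLaw c x = PMF.normalize (fun y => (rate c x y : ℝ≥0∞)) h0 hx :=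
      dif_pos ⟨h0, hx⟩
    have h' : jumpLaw c x y = rate c x y * (exitRate c x)⁻¹ :=
      (congrFun (congrArg DFunLike.coe h) y).trans (PMF.normalize_apply h0 hx y)
    rw [h', mul_comm, mul_assoc, ENNReal.inv_mul_cancel h0 hx, mul_one]

variable [Countable S] [MeasurableSpace S] [DiscreteMeasurableSpace S]

theorem ext_of_initialCylinder {μ ν : Measure (ℕ → S)} [IsProbabilityMeasure μ]
    (h : ∀ n a, μ (initialCylinder n a) = ν (initialCylinder n a)) : μ = ν := by
  have hfam : IsProjectiveMeasureFamily
      fun I : Finset ℕ => μ.map fun Y : ℕ → S => I.restrict fun i => Y i :=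
    isProjectiveMeasureFamily_map_restrict fun i => (measurable_pi_apply i).aemeasurable
  have := fun I : Finset ℕ => Measure.isFiniteMeasure_map μ fun Y : ℕ → S => I.restrict fun i => Y i
  have hμ : IsProjectiveLimit μ
      fun I : Finset ℕ => μ.map fun Y : ℕ → S => I.restrict fun i => Y i := fun I => rfl
  refine hμ.unique ((isProjectiveLimit_nat_iff hfam ν).2 fun n => ?_)
  refine Measure.ext_of_singleton fun b => ?_
  let a : ℕ → S := fun i => if h : i ∈ Finset.Iic n then b ⟨i, h⟩ else b ⟨0, by simp⟩
  have hset : (Preorder.frestrictLe (π := fun _ => S) n) ⁻¹' ({b} : Set ((i : Finset.Iic n) → S)) =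
      initialCylinder n a := by
    ext Y
    simp only [Set.mem_preimage, Set.mem_singleton_iff, initialCylinder, Set.mem_ofPred_eq,
      funext_iff, Subtype.forall, Preorder.frestrictLe_apply, Finset.mem_Iic, a]
    exact forall₂_congr fun i hi => by rw [dif_pos hi]
  rw [Measure.map_apply (by fun_prop) (measurableSet_singleton b),
    Measure.map_apply (by fun_prop) (measurableSet_singleton b), hset, ← h]
  exact congrArg μ hset.symm

variable (c : Edge S → ℝ≥0) (x : S)

instance : IsProbabilityMeasure (jumpChain c x) := by
  unfold jumpChain
  have : ∀ n : ℕ, IsMarkovKernel ((jumpKernel c).comap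
      (fun h : (i : Finset.Iic n) → S => h ⟨n, Finset.mem_Iic.2 le_rfl⟩)
      (measurable_pi_apply _)) := fun n => inferInstance
  infer_instance

instance : IsProbabilityMeasure (walkLaw c x) := by
  unfold walkLaw; infer_instance

theorem jumpChain_cylinder_zero (a : ℕ → S) :
    jumpChain c x (initialCylinder 0 a) = Set.indicator ({a 0} : Set S) 1 x := by
  have hset : initialCylinder 0 a =
      (Preorder.frestrictLe (π := fun _ => S) 0) ⁻¹' {fun _ => a 0} := by
    ext Y
    simp only [Set.mem_preimage, Set.mem_singleton_iff, initialCylinder, Set.mem_ofPred_eq,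
      funext_iff, Subtype.forall, Preorder.frestrictLe_apply, Finset.mem_Iic]
    exact forall₂_congr fun i hi => by obtain rfl := Nat.le_zero.1 hi; rfl
  rw [hset, ← Measure.map_apply (by fun_prop) (measurableSet_singleton _), jumpChain,
    Kernel.traj_map_frestrictLe_apply, Kernel.partialTraj_self, Kernel.id_apply,
    Measure.dirac_apply' _ (measurableSet_singleton _)]
  by_cases h : x = a 0
  · subst h; simp
  · rw [Set.indicator_of_notMem, Set.indicator_of_notMem]
    · simpa using h
    · simp only [Set.mem_singleton_iff, funext_iff, not_forall]
      exact ⟨⟨0, by simp⟩, h⟩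

theorem jumpChain_cylinder_succ (n : ℕ) (a : ℕ → S) :
    jumpChain c x (initialCylinder (n + 1) a) =
      jumpChain c x (initialCylinder n a) * jumpLaw c (a n) (a (n + 1)) := by
  let b : (i : Finset.Iic n) → S := fun i => a i
  have hset : ∀ Y : ℕ → S, (Preorder.frestrictLe (π := fun _ => S) n Y = b) ↔
      Y ∈ initialCylinder n a := by
    intro Y
    simp only [initialCylinder, Set.mem_ofPred_eq,
      funext_iff, Subtype.forall, Preorder.frestrictLe_apply, Finset.mem_Iic, b]
  have hset' : initialCylinder (n + 1) a =
      (fun Y : ℕ → S => (Preorder.frestrictLe (π := fun _ => S) n Y, Y (n + 1))) ⁻¹'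
        ({b} ×ˢ {a (n + 1)}) := by
    ext Y
    simp only [Set.mem_preimage, Set.mem_prod, Set.mem_singleton_iff, hset]
    refine ⟨fun h => ⟨fun i hi => h i (by omega), h _ le_rfl⟩, fun h i hi => ?_⟩
    rcases Nat.le_succ_iff.1 hi with hi | rfl
    · exact h.1 i hi
    · exact h.2
  have hset'' : initialCylinder n a = (Preorder.frestrictLe (π := fun _ => S) n) ⁻¹' {b} := by
    ext Y; exact (hset Y).symm
  have hms : MeasurableSet (({b} : Set ((i : Finset.Iic n) → S)) ×ˢ ({a (n + 1)} : Set S)) :=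
    (measurableSet_singleton _).prod (measurableSet_singleton _)
  rw [hset', ← Measure.map_apply (by fun_prop) hms, jumpChain,
    ← Kernel.partialTraj_compProd_eq_map_traj (X := fun _ => S) zero_le,
    Measure.compProd_apply_prod (measurableSet_singleton _) (measurableSet_singleton _),
    hset'', ← Measure.map_apply (by fun_prop) (measurableSet_singleton _),
    Kernel.traj_map_frestrictLe_apply, lintegral_singleton, mul_comm]
  congr 1
  simp only [Kernel.comap_apply]
  exact PMF.toMeasure_apply_singleton _ _ (measurableSet_singleton _)

/-- After its first jump the chain starts afresh. -/
theorem jumpChain_eq_sum :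
    jumpChain c x =
      Measure.sum fun y => jumpLaw c x y • (jumpChain c y).map (seqCons x) := by
  have hm : Measurable (seqCons x : (ℕ → S) → ℕ → S) :=
    measurable_seqCons measurable_const measurable_id
  refine ext_of_initialCylinder fun n a => ?_
  rw [Measure.sum_apply _ (measurableSet_initialCylinder n a)]
  simp only [Measure.smul_apply, smul_eq_mul,
    Measure.map_apply hm (measurableSet_initialCylinder n a)]
  have hpre0 : (seqCons x) ⁻¹' (initialCylinder 0 a) = {_Y | x = a 0} := by
    ext Y
    simp only [initialCylinder, Nat.le_zero, Set.mem_preimage, Set.mem_ofPred_eq]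
    exact ⟨fun h => h 0 rfl, fun h i hi => by subst hi; exact h⟩
  have hpre : ∀ n, (seqCons x) ⁻¹' (initialCylinder (n + 1) a) =
      {Y | x = a 0} ∩ initialCylinder n fun i => a (i + 1) := by
    intro n
    ext Y
    simp only [initialCylinder, Set.mem_preimage, Set.mem_ofPred_eq, Set.mem_inter_iff]
    refine ⟨fun h => ⟨h 0 zero_le, fun i hi => h (i + 1) (by omega)⟩, fun h i hi => ?_⟩
    cases i with
    | zero => exact h.1
    | succ i => exact h.2 i (by omega)
  have hone : ∑' y, jumpLaw c x y = 1 := PMF.tsum_coe _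
  by_cases hx : x = a 0
  · induction n with
    | zero =>
      rw [hpre0, jumpChain_cylinder_zero]
      rw [Set.indicator_of_mem (by exact hx), Pi.one_apply, ← hone]
      exact tsum_congr fun y => by simp [hx]
    | succ n ih =>
      have hpre' : ∀ n, (seqCons x) ⁻¹' (initialCylinder (n + 1) a) =
          initialCylinder n fun i => a (i + 1) := fun n => by
        rw [hpre, Set.inter_eq_right]
        exact fun _ _ => hx
      simp only [hpre']
      cases n with
      | zero =>
        rw [jumpChain_cylinder_succ, jumpChain_cylinder_zero]
        simp only [jumpChain_cylinder_zero]
        rw [tsum_eq_single (a 1)]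
        · simp [← hx]
        · intro y hy
          simp [hy]
      | succ n =>
        rw [jumpChain_cylinder_succ, ih]
        simp only [hpre']
        simp only [jumpChain_cylinder_succ c _ n fun i => a (i + 1), ← mul_assoc]
        rw [ENNReal.tsum_mul_right]
  · have hzero : jumpChain c x (initialCylinder n a) = 0 := by
      refine measure_mono_null (t := initialCylinder 0 a) (fun Y h i hi => h i (by omega)) ?_
      rw [jumpChain_cylinder_zero]
      exact Set.indicator_of_notMem (s := {a 0}) hx _
    rw [hzero]
    refine (ENNReal.tsum_eq_zero.2 fun y => ?_).symm
    cases n with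
    | zero => rw [hpre0]; simp [hx]
    | succ n => rw [hpre]; simp [hx]

/-- The probability that the walk makes fewer than `n` jumps up to time `t`. -/
noncomputable def fewJumps (n : ℕ) (x : S) (t : ℝ≥0) : ℝ≥0∞ :=
  walkLaw c x {w | (t : ℝ≥0∞) < jumpTime c n w}

/-- The decomposition of the walk at its first jump. -/
theorem fewJumps_succ (n : ℕ) (t : ℝ≥0) :
    fewJumps c (n + 1) x t = ∑' y, jumpLaw c x y * ∫⁻ w, expMeasure 1
      {b | (t : ℝ≥0∞) < ENNReal.ofReal b / exitRate c x + jumpTime c n w} ∂walkLaw c y := by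
  let E := Measure.infinitePi fun _ : ℕ => expMeasure 1
  have hA : MeasurableSet {w : (ℕ → S) × (ℕ → ℝ) | (t : ℝ≥0∞) < jumpTime c (n + 1) w} :=
    measurableSet_lt measurable_const (measurable_jumpTime c (n + 1))
  have hcons : Measurable (seqCons x : (ℕ → S) → ℕ → S) :=
    measurable_seqCons measurable_const measurable_id
  have hcons' : Measurable fun p : ℝ × (ℕ → ℝ) => seqCons p.1 p.2 :=
    measurable_seqCons measurable_fst measurable_snd
  have htime : ∀ Y b f, jumpTime c (n + 1) (seqCons x Y, seqCons b f) =
      ENNReal.ofReal b / exitRate c x + jumpTime c n (Y, f) := by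
    intro Y b f
    simp only [jumpTime, Finset.sum_range_succ', seqCons]
    rw [add_comm]
  -- condition on the first site visited after `x`, for fixed waiting times
  have h1 : ∀ f : ℕ → ℝ, jumpChain c x {Y | (t : ℝ≥0∞) < jumpTime c (n + 1) (Y, f)} =
      ∑' y, jumpLaw c x y *
        jumpChain c y {Y | (t : ℝ≥0∞) < jumpTime c (n + 1) (seqCons x Y, f)} := by
    intro f
    have hAf : MeasurableSet {Y : ℕ → S | (t : ℝ≥0∞) < jumpTime c (n + 1) (Y, f)} :=
      measurable_prodMk_right hA
    conv_lhs => rw [jumpChain_eq_sum]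
    rw [Measure.sum_apply _ hAf]
    simp only [Measure.smul_apply, smul_eq_mul, Measure.map_apply hcons hAf]
    rfl
  have hB : ∀ y : S, MeasurableSet {p : ((ℕ → S) × (ℕ → ℝ)) × ℝ |
      (t : ℝ≥0∞) < ENNReal.ofReal p.2 / exitRate c x + jumpTime c n p.1} := fun y =>
    measurableSet_lt measurable_const (((ENNReal.measurable_ofReal.comp measurable_snd).div_const
      _).add ((measurable_jumpTime c n).comp measurable_fst))
  calc fewJumps c (n + 1) x t
      = ∫⁻ f, jumpChain c x {Y | (t : ℝ≥0∞) < jumpTime c (n + 1) (Y, f)} ∂E :=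
        Measure.prod_apply_symm hA
    _ = ∑' y, jumpLaw c x y * ∫⁻ f, jumpChain c y
          {Y | (t : ℝ≥0∞) < jumpTime c (n + 1) (seqCons x Y, f)} ∂E := by
        have hAx : MeasurableSet {w : (ℕ → S) × (ℕ → ℝ) |
            (t : ℝ≥0∞) < jumpTime c (n + 1) (seqCons x w.1, w.2)} :=
          ((hcons.comp measurable_fst).prodMk measurable_snd) hA
        have hmeas : ∀ y, Measurable fun f : ℕ → ℝ => jumpChain c y
            {Y | (t : ℝ≥0∞) < jumpTime c (n + 1) (seqCons x Y, f)} :=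
          fun y => measurable_measure_prodMk_right hAx
        simp only [h1]
        rw [lintegral_tsum fun y => ((hmeas y).const_mul _).aemeasurable]
        exact tsum_congr fun y => lintegral_const_mul _ (hmeas y)
    _ = _ := by
        refine tsum_congr fun y => ?_
        congr 1
        have hAx : MeasurableSet {w : (ℕ → S) × (ℕ → ℝ) |
            (t : ℝ≥0∞) < jumpTime c (n + 1) (seqCons x w.1, w.2)} :=
          ((hcons.comp measurable_fst).prodMk measurable_snd) hA
        have hmeas : Measurable fun f : ℕ → ℝ => jumpChain c y
            {Y | (t : ℝ≥0∞) < jumpTime c (n + 1) (seqCons x Y, f)} :=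
          measurable_measure_prodMk_right hAx
        have e1 : ∫⁻ f, jumpChain c y
            {Y | (t : ℝ≥0∞) < jumpTime c (n + 1) (seqCons x Y, f)} ∂E =
            ∫⁻ b, ∫⁻ f, jumpChain c y {Y | (t : ℝ≥0∞) <
              ENNReal.ofReal b / exitRate c x + jumpTime c n (Y, f)} ∂E ∂expMeasure 1 := by
          conv_lhs => rw [show E = _ from (map_seqCons_infinitePi (expMeasure 1)).symm]
          rw [lintegral_map hmeas hcons', lintegral_prod (fun p : ℝ × (ℕ → ℝ) => jumpChain c y
            {Y | (t : ℝ≥0∞) < jumpTime c (n + 1) (seqCons x Y, seqCons p.1 p.2)})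
            (hmeas.comp hcons').aemeasurable]
          simp only [htime]
          rfl
        rw [e1]
        have e2 : ∀ b : ℝ, ∫⁻ f, jumpChain c y {Y | (t : ℝ≥0∞) <
              ENNReal.ofReal b / exitRate c x + jumpTime c n (Y, f)} ∂E =
            walkLaw c y {w | (t : ℝ≥0∞) <
              ENNReal.ofReal b / exitRate c x + jumpTime c n w} := fun b =>
          (Measure.prod_apply_symm (measurable_prodMk_right (hB y))).symm
        simp only [e2]
        have e3 := Measure.prod_apply (μ := walkLaw c y) (ν := expMeasure 1) (hB y)
        rw [Measure.prod_apply_symm (hB y)] at e3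
        exact e3

theorem expMeasure_Ioi {a : ℝ} (ha : 0 ≤ a) :
    expMeasure 1 (Set.Ioi a) = ENNReal.ofReal (Real.exp (-a)) := by
  have h := cdf_expMeasure_eq one_pos a
  rw [if_pos ha, one_mul, cdf_eq_real] at h
  rw [← Set.compl_Iic, prob_compl_eq_one_sub measurableSet_Iic, ← ofReal_measureReal, h,
    ← ENNReal.ofReal_one, ← ENNReal.ofReal_sub _ (by
      have := Real.exp_le_one_iff.2 (neg_nonpos.2 ha); linarith)]
  congr 1
  ring

/-- The lack of memory of the exponential law, for a waiting time `ξ / C` that is followed by a time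
`s`: if the sum exceeds `t + h`, then either `ξ / C > h`, and the residual waiting time is again
exponential, or `ξ / C ≤ h`, which has probability at most `C h`, and `s > t`. -/
theorem exp_memoryless {C : ℝ≥0∞} (hC : C ≠ ∞) (t h : ℝ≥0) (s : ℝ≥0∞) :
    expMeasure 1 {b | ((t + h : ℝ≥0) : ℝ≥0∞) < ENNReal.ofReal b / C + s} ≤
      ENNReal.ofReal (Real.exp (-(C.toNNReal * h))) *
          expMeasure 1 {b | (t : ℝ≥0∞) < ENNReal.ofReal b / C + s} +
        C * h * Set.indicator {s | (t : ℝ≥0∞) < s} 1 s := by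
  lift C to ℝ≥0 using hC
  rw [ENNReal.toNNReal_coe]
  by_cases hts : (t : ℝ≥0∞) < s
  · have hone : expMeasure 1 {b | (t : ℝ≥0∞) < ENNReal.ofReal b / C + s} = 1 := by
      rw [← measure_univ (μ := expMeasure 1)]
      congr 1
      exact Set.eq_univ_of_forall fun b => hts.trans_le le_add_self
    rw [hone, mul_one, Set.indicator_of_mem (by exact hts), Pi.one_apply, mul_one]
    refine prob_le_one.trans ?_
    rw [← ENNReal.coe_mul, ← ENNReal.ofReal_coe_nnreal,
      ← ENNReal.ofReal_add (Real.exp_pos _).le (NNReal.coe_nonneg _), ← ENNReal.ofReal_one]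
    refine ENNReal.ofReal_le_ofReal ?_
    push_cast
    have := Real.add_one_le_exp (-((C : ℝ) * h))
    linarith
  · rw [Set.indicator_of_notMem (by exact hts), mul_zero, add_zero]
    rw [not_lt] at hts
    lift s to ℝ≥0 using ne_top_of_le_ne_top ENNReal.coe_ne_top hts
    rw [ENNReal.coe_le_coe] at hts
    rcases eq_or_ne C 0 with rfl | hC0
    · simp only [NNReal.coe_zero, zero_mul, neg_zero, Real.exp_zero, ENNReal.ofReal_one, one_mul]
      refine measure_mono fun b hb => lt_of_le_of_lt ?_ (Set.mem_ofPred_eq ▸ hb)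
      exact_mod_cast le_add_right (le_refl t)
    · -- both events are of the form `{b > a}`
      have hset : ∀ u : ℝ≥0, s ≤ u → {b : ℝ | (u : ℝ≥0∞) < ENNReal.ofReal b / C + s} =
          Set.Ioi ((C : ℝ) * (u - s)) := by
        intro u hu
        have hC' : (0 : ℝ) < C := by exact_mod_cast pos_iff_ne_zero.2 hC0
        ext b
        simp only [Set.mem_ofPred_eq, Set.mem_Ioi, ENNReal.ofReal]
        rw [← ENNReal.coe_div hC0, ← ENNReal.coe_add, ENNReal.coe_lt_coe, ← NNReal.coe_lt_coe]
        push_cast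
        rw [Real.coe_toNNReal', ← sub_lt_iff_lt_add, lt_div_iff₀' hC', lt_max_iff, or_iff_left]
        refine not_lt.2 (mul_nonneg hC'.le (sub_nonneg.2 ?_))
        exact_mod_cast hu
      have hs : (s : ℝ) ≤ t := by exact_mod_cast hts
      rw [hset _ (hts.trans (le_add_right le_rfl)), hset _ hts, expMeasure_Ioi, expMeasure_Ioi,
        ← ENNReal.ofReal_mul (Real.exp_pos _).le, ← Real.exp_add]
      · refine le_of_eq ?_
        congr 2
        push_cast
        ring
      · exact mul_nonneg C.2 (sub_nonneg.2 hs)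
      · refine mul_nonneg C.2 (sub_nonneg.2 (hs.trans ?_))
        push_cast
        exact le_add_of_nonneg_right h.2

/-- If the walk makes at most `n` jumps up to time `t + h`, then either its first waiting time
exceeds `h`, and by the lack of memory it may be started afresh after time `h`, or it jumps before time `h`,
and makes fewer than `n` jumps during the time `t` that follows. -/
theorem fewJumps_succ_le {x : S} (hx : exitRate c x ≠ ∞) (n : ℕ) (t h : ℝ≥0) :
    fewJumps c (n + 1) x (t + h) ≤
      ENNReal.ofReal (Real.exp (-(totalRate c x * h))) * fewJumps c (n + 1) x t +
        ∑' y, rate c x y * h * fewJumps c n y t := by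
  rw [fewJumps_succ, fewJumps_succ, ← ENNReal.tsum_mul_left, ← ENNReal.tsum_add]
  refine ENNReal.tsum_le_tsum fun y => ?_
  have hB : MeasurableSet {p : ((ℕ → S) × (ℕ → ℝ)) × ℝ |
      (t : ℝ≥0∞) < ENNReal.ofReal p.2 / exitRate c x + jumpTime c n p.1} :=
    measurableSet_lt measurable_const (((ENNReal.measurable_ofReal.comp measurable_snd).div_const
      _).add ((measurable_jumpTime c n).comp measurable_fst))
  have hm : Measurable fun w => expMeasure 1
      {b | (t : ℝ≥0∞) < ENNReal.ofReal b / exitRate c x + jumpTime c n w} :=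
    measurable_measure_prodMk_left hB
  have hm' : MeasurableSet {w : (ℕ → S) × (ℕ → ℝ) | (t : ℝ≥0∞) < jumpTime c n w} :=
    measurableSet_lt measurable_const (measurable_jumpTime c n)
  calc _ ≤ jumpLaw c x y * ∫⁻ w, (ENNReal.ofReal (Real.exp (-(totalRate c x * h))) *
          expMeasure 1 {b | (t : ℝ≥0∞) < ENNReal.ofReal b / exitRate c x + jumpTime c n w} +
        exitRate c x * h * {w | (t : ℝ≥0∞) < jumpTime c n w}.indicator 1 w) ∂walkLaw c y :=
        mul_le_mul_right (lintegral_mono fun w => exp_memoryless hx t h _) _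
    _ = jumpLaw c x y * (ENNReal.ofReal (Real.exp (-(totalRate c x * h))) * ∫⁻ w, expMeasure 1
          {b | (t : ℝ≥0∞) < ENNReal.ofReal b / exitRate c x + jumpTime c n w} ∂walkLaw c y +
        exitRate c x * h * fewJumps c n y t) := by
        rw [lintegral_add_left (hm.const_mul _), lintegral_const_mul _ hm, lintegral_const_mul _
          (measurable_one.indicator hm'), lintegral_indicator_one hm']
        rfl
    _ = ENNReal.ofReal (Real.exp (-(totalRate c x * h))) * (jumpLaw c x y * ∫⁻ w, expMeasure 1
          {b | (t : ℝ≥0∞) < ENNReal.ofReal b / exitRate c x + jumpTime c n w} ∂walkLaw c y) +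
        exitRate c x * jumpLaw c x y * h * fewJumps c n y t := by ring
    _ ≤ _ := by
        gcongr
        exact exitRate_mul_jumpLaw_le c hx y

theorem fewJumps_zero (t : ℝ≥0) : fewJumps c 0 x t = 0 := by
  simp [fewJumps, jumpTime]

theorem fewJumps_le_one (n : ℕ) (t : ℝ≥0) : fewJumps c n x t ≤ 1 := prob_le_one

/-- Without explosion, the walk makes finitely many jumps up to time `t`. -/
theorem tendsto_fewJumps {x : S} (hx : NoExplosion c x) (t : ℝ≥0) :
    Tendsto (fun n => fewJumps c n x t) atTop (𝓝 1) := by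
  have hmono : Monotone fun n => {w : (ℕ → S) × (ℕ → ℝ) | (t : ℝ≥0∞) < jumpTime c n w} := by
    intro m n hmn w hw
    refine lt_of_lt_of_le (show (t : ℝ≥0∞) < jumpTime c m w from hw) ?_
    exact Finset.sum_le_sum_of_subset (Finset.range_mono hmn)
  have hone : walkLaw c x (⋃ n, {w | (t : ℝ≥0∞) < jumpTime c n w}) = 1 := by
    refine prob_compl_eq_zero_iff
      (MeasurableSet.iUnion fun n => measurableSet_lt measurable_const (measurable_jumpTime c n))
      |>.1 (measure_mono_null (fun w hw => ?_) (ae_iff.1 hx))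
    refine fun htop => hw (Set.mem_iUnion.2 ?_)
    have hlim := (ENNReal.summable (f := fun n =>
      ENNReal.ofReal (w.2 n) / exitRate c (w.1 n))).hasSum.tendsto_sum_nat
    rw [htop] at hlim
    exact (hlim.eventually (lt_mem_nhds ENNReal.coe_lt_top)).exists
  rw [← hone]
  exact tendsto_measure_iUnion_atTop hmono

end Walk

/-! ### Termination of the exploration by comparison with the random walk -/

section Comparison

theorem natCast_mul_div_mem_ratTimes {t : ℝ≥0} (ht : t ∈ ratTimes) (j k : ℕ) :
    j * (t / k) ∈ ratTimes := by
  obtain ⟨q, rfl⟩ := ht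
  exact ⟨j * (q / k), by push_cast; rfl⟩

theorem countable_ratTimes : ratTimes.Countable := Set.countable_range _

variable {S : Type*}

theorem measurableSet_past_quiet [Countable S] (B : Set (Edge S)) {q r t : ℝ≥0} (hq : q ≤ t)
    (hr : r ≤ t) : MeasurableSet[pastSigma S t] {K : Clocks S | Quiet K B q r} := by
  simp only [Quiet, Set.ofPred_forall]
  exact MeasurableSet.iInter fun e => MeasurableSet.iInter fun _ =>
    measurableSet_eq_fun (measurable_eval_past hq e) (measurable_eval_past hr e)

theorem measurableSet_past_singleRing [Countable S] {x y : S} (h : x ≠ y) {q r t : ℝ≥0}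
    (hq : q ≤ t) (hr : r ≤ t) :
    MeasurableSet[pastSigma S t] {K : Clocks S | SingleRing K h q r} :=
  (measurableSet_eq_fun (measurable_eval_past hr _)
    ((measurable_eval_past hq _).add_const 1)).inter (measurableSet_past_quiet _ hq hr)

/-- The outcome of the exploration up to time `t` depends only on the clocks up to time `t`. -/
theorem measurableSet_past_reach [Countable S] (n : ℕ) (x : S) (t : ℝ≥0) (z : S) :
    MeasurableSet[pastSigma S t] {K : Clocks S | Reach K n x t z} := by
  have halt : ∀ (x : S) (t : ℝ≥0),
      MeasurableSet[pastSigma S t] {K : Clocks S | x = z ∧ Quiet K (star x) 0 t} := fun x t =>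
    (MeasurableSet.const _).inter (measurableSet_past_quiet _ zero_le le_rfl)
  induction n generalizing x t with
  | zero => exact halt x t
  | succ n ih =>
    have heq : {K : Clocks S | Reach K (n + 1) x t z} = {K | x = z ∧ Quiet K (star x) 0 t} ∪
        ⋃ (y : S) (h : x ≠ y), ⋃ q ∈ ratTimes, ⋃ r ∈ insert t ratTimes, ⋃ (_ : q ≤ r) (_ : r ≤ t),
          {K | Quiet K (star x) r t} ∩ ({K | SingleRing K h q r} ∩ {K | Reach K n y q z}) := by
      ext K
      simp only [Set.mem_union, Set.mem_iUnion, Set.mem_inter_iff, Set.mem_ofPred_eq, exists_prop,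
        Reach]
    rw [heq]
    refine (halt x t).union (MeasurableSet.iUnion fun y => MeasurableSet.iUnion fun h =>
      MeasurableSet.biUnion countable_ratTimes fun q _ =>
      MeasurableSet.biUnion (countable_ratTimes.insert t) fun r _ =>
      MeasurableSet.iUnion fun hqr => MeasurableSet.iUnion fun hrt => ?_)
    exact (measurableSet_past_quiet _ hrt le_rfl).inter
      ((measurableSet_past_singleRing h (hqr.trans hrt) hrt).inter
        (pastSigma_mono (hqr.trans hrt) _ (ih y q)))

/-- The probability that the exploration from `x` of the jump times in `[0, t]` stops after at
most `n` moves. -/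
noncomputable def reachProb (Pr : Measure (Clocks S)) (n : ℕ) (x : S) (t : ℝ≥0) : ℝ≥0∞ :=
  Pr {K | ∃ z, Reach K n x t z}

theorem measurableSet_past_exists_reach [Countable S] (n : ℕ) (x : S) (t : ℝ≥0) :
    MeasurableSet[pastSigma S t] {K : Clocks S | ∃ z, Reach K n x t z} := by
  simp only [Set.ofPred_exists]
  exact MeasurableSet.iUnion fun z => measurableSet_past_reach n x t z

variable {c : Edge S → ℝ≥0} {Pr : Measure (Clocks S)}

theorem reachProb_time_zero (hPr : IsPoissonClockLaw c Pr) (n : ℕ) (x : S) :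
    reachProb Pr n x 0 = 1 := by
  have := hPr.isProbabilityMeasure
  have : {K : Clocks S | ∃ z, Reach K n x 0 z} = Set.univ := by
    refine Set.eq_univ_of_forall fun K => ⟨x, ?_⟩
    cases n with
    | zero => exact ⟨rfl, fun _ _ => rfl⟩
    | succ n => exact .inl ⟨rfl, fun _ _ => rfl⟩
  rw [reachProb, this, measure_univ]

theorem SingleRing.not_quiet {K : Clocks S} {x y : S} {h : x ≠ y} {q r : ℝ≥0}
    (hs : SingleRing K h q r) {B : Set (Edge S)} (hB : edge h ∈ B) : ¬ Quiet K B q r := fun hq => by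
  have h1 := hq _ hB
  have h2 := hs.1
  omega

theorem SingleRing.eq_of_eq {K : Clocks S} {x y y' : S} {h : x ≠ y} {h' : x ≠ y'} {q r : ℝ≥0}
    (hs : SingleRing K h q r) (hs' : SingleRing K h' q r) : y = y' := by
  by_contra hne
  refine hs.not_quiet (B := (star x ∪ star y') \ {edge h'}) ⟨.inl (edge_mem_star h), ?_⟩ hs'.2
  exact fun heq => hne ((edge_eq_iff h h').1 heq)

/-- The first step decomposition of the exploration backward from time `t + h`, as an inequality:
either no clock at `x` rings in `(t, t + h]`, or the clock of a single pair `{x, y}` does. -/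
theorem le_reachProb_succ [Countable S] (hPr : IsPoissonClockLaw c Pr)
    (hc : ∀ x, exitRate c x ≠ ∞) (n : ℕ) (x : S) {t : ℝ≥0} (ht : t ∈ ratTimes) (h : ℝ≥0) :
    ENNReal.ofReal (Real.exp (-(totalRate c x * h))) * reachProb Pr (n + 1) x t +
      ∑' y, rate c x y * h * (ENNReal.ofReal
        (Real.exp (-((totalRate c x + totalRate c y : ℝ≥0) * h))) * reachProb Pr n y t) ≤
      reachProb Pr (n + 1) x (t + h) := by
  let Q : Set (Clocks S) := {K | ∃ z, Reach K (n + 1) x t z} ∩ {K | Quiet K (star x) t (t + h)}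
  let R : S → Set (Clocks S) := fun y =>
    {K | ∃ z, Reach K n y t z} ∩ {K | ∃ hxy : x ≠ y, SingleRing K hxy t (t + h)}
  have hR : ∀ y, MeasurableSet (R y) := fun y => by
    refine (pastSigma_le t _ (measurableSet_past_exists_reach n y t)).inter ?_
    simp only [Set.ofPred_exists]
    exact MeasurableSet.iUnion fun hxy => measurableSet_singleRing hxy _ _
  have hdis : Pairwise (Function.onFun Disjoint R) := fun y y' hne =>
    Set.disjoint_left.2 fun K ⟨_, _, h1⟩ ⟨_, _, h2⟩ => hne (h1.eq_of_eq h2)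
  have hdis' : Disjoint Q (⋃ y, R y) := Set.disjoint_left.2 fun K hQ hK => by
    obtain ⟨y, -, hxy, h1⟩ := Set.mem_iUnion.1 hK
    exact h1.not_quiet (edge_mem_star hxy) hQ.2
  have hsub : Q ∪ ⋃ y, R y ⊆ {K | ∃ z, Reach K (n + 1) x (t + h) z} := by
    have hle : t ≤ t + h := le_add_right le_rfl
    rintro K (⟨⟨z, hz⟩, hq⟩ | hK)
    · exact ⟨z, hz.extend ht hle hq⟩
    · obtain ⟨y, ⟨z, hz⟩, hxy, h1⟩ := Set.mem_iUnion.1 hK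
      exact ⟨z, .move hxy ht hle h1 hz⟩
  refine le_trans ?_ (measure_mono hsub)
  rw [measure_union hdis' (MeasurableSet.iUnion hR), measure_iUnion hdis hR]
  refine add_le_add ?_ (ENNReal.tsum_le_tsum fun y => ?_)
  · rw [mul_comm]
    exact hPr.le_measure_inter_quiet (hc x) h (measurableSet_past_exists_reach _ _ _)
  · by_cases hxy : x = y
    · simp [rate, hxy]
    · have := hPr.le_measure_inter_singleRing hxy (hc x) (hc y) h
        (measurableSet_past_exists_reach n y t)
      rw [ENNReal.ofReal_mul (by positivity), ENNReal.ofReal_mul (by positivity),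
        ENNReal.ofReal_coe_nnreal, ENNReal.ofReal_coe_nnreal] at this
      simp only [rate, dif_pos hxy]
      refine le_trans (le_of_eq ?_) (this.trans (measure_mono fun K hK => ⟨hK.1, hxy, hK.2⟩))
      rw [reachProb]
      ring

/-- A bound for the rate of the moves `{x, y}` from `x` that are spoiled by another ring at `x` or
`y` within time `h`. -/
noncomputable def secondRingRate (c : Edge S → ℝ≥0) (x : S) (h : ℝ≥0) : ℝ≥0∞ :=
  ∑' y, rate c x y *
    ENNReal.ofReal (1 - Real.exp (-((totalRate c x + totalRate c y : ℝ≥0) * h)))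

theorem tendsto_secondRingRate {x : S} (hx : exitRate c x ≠ ∞) {u : ℕ → ℝ≥0}
    (hu : Tendsto u atTop (𝓝 0)) :
    Tendsto (fun k => secondRingRate c x (u k)) atTop (𝓝 0) := by
  let _ : MeasurableSpace S := ⊤
  have : DiscreteMeasurableSpace S := ⟨fun _ => trivial⟩
  simp only [secondRingRate, ← lintegral_count]
  rw [show (0 : ℝ≥0∞) = ∫⁻ _ : S, 0 ∂Measure.count by simp]
  refine tendsto_lintegral_of_dominated_convergence (fun y => (rate c x y : ℝ≥0∞))
    (fun _ => Measurable.of_discrete) (fun k => Eventually.of_forall fun y => ?_) ?_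
    (Eventually.of_forall fun y => ?_)
  · refine mul_le_of_le_one_right zero_le ?_
    rw [ENNReal.ofReal_le_one]
    linarith [Real.exp_pos (-((totalRate c x + totalRate c y : ℝ≥0) * (u k : ℝ)))]
  · rw [lintegral_count]
    exact hx
  · have h1 : Tendsto (fun k => 1 - Real.exp (-((totalRate c x + totalRate c y : ℝ≥0) * (u k : ℝ))))
        atTop (𝓝 0) := by
      have h2 := ((NNReal.tendsto_coe.2 hu).const_mul
        ((totalRate c x + totalRate c y : ℝ≥0) : ℝ)).neg
      have h3 := ((Real.continuous_exp.tendsto _).comp h2).const_sub 1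
      simpa using h3
    have h4 := ENNReal.Tendsto.const_mul (a := (rate c x y : ℝ≥0∞)) (ENNReal.tendsto_ofReal h1)
      (.inr ENNReal.coe_ne_top)
    simpa using h4

theorem le_exp_mul_add {a : ℝ≥0} {f v : ℝ≥0∞} (hf : f ≤ 1) (hfv : f ≤ v) (h : ℝ≥0) :
    f ≤ ENNReal.ofReal (Real.exp (-(a * h))) * v + ENNReal.ofReal (1 - Real.exp (-(a * h))) := by
  have hexp : Real.exp (-(a * h)) ≤ 1 := Real.exp_le_one_iff.2 (by simp; positivity)
  calc f = (ENNReal.ofReal (Real.exp (-(a * h))) +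
        ENNReal.ofReal (1 - Real.exp (-(a * h)))) * f := by
        rw [← ENNReal.ofReal_add (Real.exp_pos _).le (by linarith)]
        simp
    _ ≤ _ := by
        rw [add_mul]
        gcongr
        exact mul_le_of_le_one_right zero_le hf

/-- The exploration stops after at most `n` moves at least as likely as the random walk makes fewer
than `n` jumps. The time is cut into `k` steps; at each step both probabilities obey the same first
step inequality up to an error `o(1 / k)`. -/
theorem fewJumps_le_reachProb [Countable S] [MeasurableSpace S] [DiscreteMeasurableSpace S]
    (hPr : IsPoissonClockLaw c Pr) (hc : ∀ x, exitRate c x ≠ ∞) (n : ℕ) (x : S) {t : ℝ≥0}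
    (ht : t ∈ ratTimes) : fewJumps c n x t ≤ reachProb Pr n x t := by
  induction n generalizing x t with
  | zero => rw [fewJumps_zero]; exact zero_le
  | succ n ih =>
    have step : ∀ k j : ℕ, fewJumps c (n + 1) x (j * (t / k)) ≤
        reachProb Pr (n + 1) x (j * (t / k)) +
          j * ((t / k : ℝ≥0) * secondRingRate c x (t / k)) := by
      intro k j
      induction j with
      | zero =>
        simp only [Nat.cast_zero, zero_mul, reachProb_time_zero hPr, add_zero]
        exact fewJumps_le_one c x _ _
      | succ j ihj =>
        have hs := natCast_mul_div_mem_ratTimes ht j k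
        have hsucc : ((j + 1 : ℕ) : ℝ≥0) * (t / k) = j * (t / k) + t / k := by push_cast; ring
        rw [hsucc]
        generalize t / k = h at *
        set s := j * h
        have h1 := fewJumps_succ_le c (hc x) n s h
        have h2 := le_reachProb_succ hPr hc n x hs h
        have hexp : ENNReal.ofReal (Real.exp (-(totalRate c x * h))) ≤ 1 :=
          ENNReal.ofReal_le_one.2 (Real.exp_le_one_iff.2 (by simp; positivity))
        have h3 : ∑' y, rate c x y * h * fewJumps c n y s ≤
            ∑' y, rate c x y * h * (ENNReal.ofReal
              (Real.exp (-((totalRate c x + totalRate c y : ℝ≥0) * h))) * reachProb Pr n y s) +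
            h * secondRingRate c x h := by
          rw [secondRingRate, ← ENNReal.tsum_mul_left, ← ENNReal.tsum_add]
          refine ENNReal.tsum_le_tsum fun y => ?_
          have := le_exp_mul_add (a := totalRate c x + totalRate c y) (fewJumps_le_one c y n s)
            (ih y hs) h
          refine (mul_le_mul_right this _).trans (le_of_eq ?_)
          ring
        calc _ ≤ _ := h1
          _ ≤ ENNReal.ofReal (Real.exp (-(totalRate c x * h))) *
                (reachProb Pr (n + 1) x s + j * (h * secondRingRate c x h)) + _ :=
              add_le_add (mul_le_mul_right ihj _) h3
          _ ≤ ENNReal.ofReal (Real.exp (-(totalRate c x * h))) * reachProb Pr (n + 1) x s +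
                j * (h * secondRingRate c x h) + _ := by
              rw [mul_add]
              exact add_le_add_left (add_le_add_right (mul_le_of_le_one_left zero_le hexp) _) _
          _ ≤ _ := by
              refine le_trans (le_of_eq ?_) (add_le_add_left h2 _)
              push_cast
              ring
    have hlim : Tendsto (fun k : ℕ => reachProb Pr (n + 1) x t + t * secondRingRate c x (t / k))
        atTop (𝓝 (reachProb Pr (n + 1) x t)) := by
      have h1 : Tendsto (fun k : ℕ => t / (k : ℝ≥0)) atTop (𝓝 0) :=
        NNReal.tendsto_coe.1 (by
          simpa using tendsto_const_div_atTop_nhds_zero_nat (t : ℝ))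
      have h2 := ENNReal.Tendsto.const_mul (a := (t : ℝ≥0∞)) (tendsto_secondRingRate (hc x) h1)
        (.inr ENNReal.coe_ne_top)
      simpa using h2.const_add (reachProb Pr (n + 1) x t)
    refine ge_of_tendsto hlim ?_
    filter_upwards [eventually_gt_atTop 0] with k hk
    have hk' : (k : ℝ≥0) ≠ 0 := by positivity
    have h1 := step k k
    rw [mul_div_cancel₀ t hk'] at h1
    refine h1.trans (le_of_eq ?_)
    rw [← mul_assoc]
    congr 2
    rw [← ENNReal.coe_natCast, ← ENNReal.coe_mul, mul_div_cancel₀ t hk']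

/-- Almost every realization of the clocks is regular and lies in `Γ_*`. -/
theorem IsPoissonClockLaw.ae_mem_gammaStar [Countable S] [MeasurableSpace S]
    [DiscreteMeasurableSpace S] (hPr : IsPoissonClockLaw c Pr) (hc : WalkWellDefined c) :
    ∀ᵐ K ∂Pr, Regular K ∧ K ∈ gammaStar S := by
  have := hPr.isProbabilityMeasure
  have hone : ∀ x, ∀ q : ℚ≥0, ∀ᵐ K ∂Pr, ∃ n z, Reach K n x q z := by
    intro x q
    rw [ae_iff]
    have hm : MeasurableSet {K : Clocks S | ∃ n z, Reach K n x q z} := by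
      rw [Set.ofPred_exists]
      exact MeasurableSet.iUnion fun n =>
        pastSigma_le _ _ (measurableSet_past_exists_reach n x q)
    refine (prob_compl_eq_zero_iff hm).2 (le_antisymm prob_le_one ?_)
    refine le_of_tendsto' (tendsto_fewJumps c (hc.noExplosion x) q) fun n => ?_
    exact (fewJumps_le_reachProb hPr hc.exitRate_ne_top n x ⟨q, rfl⟩).trans
      (measure_mono fun K hK => ⟨n, hK⟩)
  filter_upwards [hPr.ae_regular hc.exitRate_ne_top,
    ae_all_iff.2 fun x => ae_all_iff.2 fun q => hone x q] with K hK h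
  refine ⟨hK, mem_gammaStar_of_regular hK (hK.stir_ne_none ?_)⟩
  rintro x _ ⟨q, rfl⟩
  exact h x q

end Comparison

/-! ### Measurability of the stirring construction -/

section Measurability

variable {S : Type*}

open Classical in
/-- A version of `config` that is measurable, also in `σ`; by `Regular.configVersion_eq` it agrees
with `config` wherever `K` is regular and the exploration terminates. -/
noncomputable def configVersion (σ : S → Bool) (K : Clocks S) (t : ℝ≥0) : S → Bool :=
  fun x => decide (∃ n z, Reach K n x t z ∧ σ z = true)

theorem Regular.configVersion_eq {K : Clocks S} (hK : Regular K) (hs : K ∈ gammaStar S)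
    (σ : S → Bool) (t : ℝ≥0) : configVersion σ K t = config σ K t := by
  funext x
  obtain ⟨z, hz⟩ := Option.ne_none_iff_exists'.1 (hs.2 t x)
  have key : (∃ n z', Reach K n x t z' ∧ σ z' = true) ↔ σ z = true := by
    constructor
    · rintro ⟨n, z', h, hσ⟩
      have := (stir_eq_some_iff_reach hK).2 ⟨n, h⟩
      rw [hz, Option.some_inj] at this
      rwa [this]
    · intro hσ
      obtain ⟨n, hn⟩ := (stir_eq_some_iff_reach hK).1 hz
      exact ⟨n, z, hn, hσ⟩
  simp only [configVersion, config, hz, Option.elim, key, Bool.decide_eq_true]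

theorem continuous_config (K : Clocks S) (t : ℝ≥0) :
    Continuous fun σ : S → Bool => config σ K t := by
  refine continuous_pi fun x => ?_
  simp only [config]
  cases stir K t x with
  | none => exact continuous_const
  | some z => exact continuous_apply z

variable [Countable S]

theorem measurable_configVersion_past (σ : S → Bool) {s t : ℝ≥0} (hst : s ≤ t) :
    Measurable[pastSigma S t] fun K : Clocks S => configVersion σ K s := by
  refine @measurable_pi_lambda _ _ _ (_) _ _ fun x => ?_
  refine @measurable_to_bool _ (_) _ ?_
  have : (fun K : Clocks S => configVersion σ K s x) ⁻¹' {true} =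
      ⋃ (n : ℕ) (z : S), {K | Reach K n x s z} ∩ {_K | σ z = true} := by
    ext K
    simp [configVersion]
  rw [this]
  exact MeasurableSet.iUnion fun n => MeasurableSet.iUnion fun z =>
    (pastSigma_mono hst _ (measurableSet_past_reach n x s z)).inter (MeasurableSet.const _)

theorem measurable_configVersion (t : ℝ≥0) :
    Measurable fun p : (S → Bool) × Clocks S => configVersion p.1 p.2 t := by
  refine measurable_pi_lambda _ fun x => measurable_to_bool ?_
  have : (fun p : (S → Bool) × Clocks S => configVersion p.1 p.2 t x) ⁻¹' {true} =
      ⋃ (n : ℕ) (z : S), (fun p => p.2) ⁻¹' {K | Reach K n x t z} ∩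
        (fun p => p.1 z) ⁻¹' {true} := by
    ext p
    simp [configVersion]
  rw [this]
  exact MeasurableSet.iUnion fun n => MeasurableSet.iUnion fun z =>
    (measurable_snd (pastSigma_le t _ (measurableSet_past_reach n x t z))).inter
      (((measurable_pi_apply z).comp measurable_fst) (measurableSet_singleton true))

end Measurability

/-! ### The law of the exclusion process and its Markov property -/

section Law

theorem canonicalFiltration_eq_comap (W : Type*) [TopologicalSpace W] [MeasurableSpace W]
    (t : ℝ≥0) : canonicalFiltration W t =
      MeasurableSpace.comap (fun (ζ : CadlagPath W) (s : Set.Iic t) => ζ.1 s) inferInstance := by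
  refine Eq.trans ?_ (MeasurableSpace.comap_iSup (ι := Set.Iic t)).symm
  simp only [MeasurableSpace.comap_comp]
  rfl

theorem measurable_comp_prodMk {α β γ : Type*} [MeasurableSpace α] [MeasurableSpace β]
    [MeasurableSpace γ] {f : α × β → γ} (hf : Measurable f) (a : α) :
    Measurable fun b => f (a, b) := hf.comp measurable_prodMk_left

theorem measurable_shift {W : Type*} [TopologicalSpace W] [MeasurableSpace W] (t : ℝ≥0) :
    Measurable (shift t : CadlagPath W → CadlagPath W) :=
  measurable_comap_iff.2 (measurable_pi_lambda _ fun s =>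
    (measurable_pi_apply (t + s)).comp measurable_subtype_coe)

theorem measurable_eval_path {W : Type*} [TopologicalSpace W] [MeasurableSpace W] (t : ℝ≥0) :
    Measurable fun ζ : CadlagPath W => ζ.1 t :=
  (measurable_pi_apply t).comp measurable_subtype_coe

variable {S : Type*} [Countable S] {c : Edge S → ℝ≥0} {Pr : Measure (Clocks S)}

namespace IsPoissonClockLaw

theorem ae_restart (hPr : IsPoissonClockLaw c Pr) {p : Clocks S → Prop} (h : ∀ᵐ K ∂Pr, p K)
    (t : ℝ≥0) : ∀ᵐ K ∂Pr, p (restart t K) := by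
  rw [← hPr.map_restart t] at h
  exact ae_of_ae_map (measurable_restart t).aemeasurable h

/-- Any function of the clocks up to time `t` is independent of the restarted clocks. -/
theorem map_prodMk_restart (hPr : IsPoissonClockLaw c Pr) {β : Type*} [MeasurableSpace β]
    {t : ℝ≥0} {V : Clocks S → β} (hV : Measurable[pastSigma S t] V) :
    Pr.map (fun K => (V K, restart t K)) = (Pr.map V).prod Pr := by
  have := hPr.isProbabilityMeasure
  have hind : IndepFun V (restart t) Pr := by
    rw [IndepFun_iff_Indep]
    exact indep_of_indep_of_le_left (hPr.indep_past_restart t) hV.comap_le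
  rw [(indepFun_iff_map_prod_eq_prod_map_map (hV.mono (pastSigma_le t) le_rfl).aemeasurable
    (measurable_restart t).aemeasurable).1 hind, hPr.map_restart]

variable [MeasurableSpace S] [DiscreteMeasurableSpace S]

theorem restrict_gammaStar (hPr : IsPoissonClockLaw c Pr) (hc : WalkWellDefined c) :
    Pr.restrict (gammaStar S) = Pr :=
  Measure.restrict_eq_self_of_ae_mem ((hPr.ae_mem_gammaStar hc).mono fun _ h => h.2)

theorem ae_configVersion_eq (hPr : IsPoissonClockLaw c Pr) (hc : WalkWellDefined c) :
    ∀ᵐ K ∂Pr, ∀ (σ : S → Bool) t, configVersion σ K t = config σ K t :=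
  (hPr.ae_mem_gammaStar hc).mono fun _ h => h.1.configVersion_eq h.2

theorem ae_configPath_apply (hPr : IsPoissonClockLaw c Pr) (hc : WalkWellDefined c) :
    ∀ᵐ K ∂Pr, ∀ (σ : S → Bool) t, (configPath σ K).1 t = config σ K t :=
  (hPr.ae_mem_gammaStar hc).mono fun K h σ t => by rw [configPath, dif_pos h.2]

theorem ae_config_zero (hPr : IsPoissonClockLaw c Pr) (hc : WalkWellDefined c) :
    ∀ᵐ K ∂Pr, ∀ σ : S → Bool, config σ K 0 = σ :=
  (hPr.ae_mem_gammaStar hc).mono fun K h σ => by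
    funext x
    have : stir K 0 x = some x := (stir_eq_some_iff_reach h.1).2 ⟨0, rfl, fun _ _ => rfl⟩
    simp [config, this]

/-- Almost surely, the path restarted at time `t` is the path of the restarted clocks with initial
configuration the one at time `t`. -/
theorem ae_config_add (hPr : IsPoissonClockLaw c Pr) (hc : WalkWellDefined c) (t : ℝ≥0) :
    ∀ᵐ K ∂Pr, ∀ (σ : S → Bool) s,
      config σ K (t + s) = config (config σ K t) (restart t K) s := by
  have h := hPr.ae_mem_gammaStar hc
  filter_upwards [h, hPr.ae_restart h t] with K h1 h2 σ s
  exact config_add h1.1 h2.1 h1.2 h2.2 σ s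

/-- The path `η^σ` has a version that is jointly measurable in `σ` and in the clocks. -/
theorem exists_measurable_path (hPr : IsPoissonClockLaw c Pr) (hc : WalkWellDefined c) :
    ∃ H : (S → Bool) × Clocks S → CadlagPath (S → Bool), Measurable H ∧
      ∀ᵐ K ∂Pr, ∀ σ, H (σ, K) = configPath σ K := by
  classical
  obtain ⟨N, hN, hNm, hN0⟩ := exists_measurable_superset_of_null
    (mem_ae_iff.1 (hPr.ae_mem_gammaStar hc))
  have hgood : ∀ K ∉ N, Regular K ∧ K ∈ gammaStar S := fun K hK => by
    by_contra h
    exact hK (hN h)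
  refine ⟨fun p => if p.2 ∈ N then
    ⟨fun _ => p.1, fun _ => continuousWithinAt_const, fun _ => ⟨p.1, tendsto_const_nhds⟩⟩
    else configPath p.1 p.2, ?_, ?_⟩
  · refine measurable_comap_iff.2 (measurable_pi_lambda _ fun t => ?_)
    have : (fun p : (S → Bool) × Clocks S => if p.2 ∈ N then p.1 else configVersion p.1 p.2 t) =
        fun p => (if p.2 ∈ N then (⟨fun _ => p.1, fun _ => continuousWithinAt_const,
          fun _ => ⟨p.1, tendsto_const_nhds⟩⟩ : CadlagPath (S → Bool))
          else configPath p.1 p.2).1 t := by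
      funext p
      split_ifs with h
      · rfl
      · rw [(hgood _ h).1.configVersion_eq (hgood _ h).2, configPath, dif_pos (hgood _ h).2]
    refine Eq.mp (congrArg Measurable this) ?_
    exact Measurable.ite (measurable_snd hNm) measurable_fst (measurable_configVersion t)
  · have : ∀ᵐ K ∂Pr, K ∉ N := measure_eq_zero_iff_ae_notMem.1 hN0
    filter_upwards [this] with K hK σ
    simp only [if_neg hK]

theorem aemeasurable_configPath (hPr : IsPoissonClockLaw c Pr) (hc : WalkWellDefined c)
    (σ : S → Bool) : AEMeasurable (configPath σ) Pr := by
  obtain ⟨H, hH, heq⟩ := hPr.exists_measurable_path hc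
  exact ⟨fun K => H (σ, K), measurable_comp_prodMk hH _, heq.mono fun K hK => (hK σ).symm⟩

theorem exclusionLaw_eq_map (hPr : IsPoissonClockLaw c Pr) (hc : WalkWellDefined c)
    {H : (S → Bool) × Clocks S → CadlagPath (S → Bool)}
    (hH : ∀ᵐ K ∂Pr, ∀ σ, H (σ, K) = configPath σ K) (σ : S → Bool) :
    exclusionLaw Pr σ = Pr.map fun K => H (σ, K) := by
  rw [exclusionLaw, hPr.restrict_gammaStar hc]
  exact Measure.map_congr (hH.mono fun K hK => (hK σ).symm)

theorem isProbabilityMeasure_exclusionLaw (hPr : IsPoissonClockLaw c Pr) (hc : WalkWellDefined c)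
    (σ : S → Bool) : IsProbabilityMeasure (exclusionLaw Pr σ) := by
  have := hPr.isProbabilityMeasure
  rw [exclusionLaw, hPr.restrict_gammaStar hc]
  exact Measure.isProbabilityMeasure_map (hPr.aemeasurable_configPath hc σ)

theorem measurable_exclusionLaw (hPr : IsPoissonClockLaw c Pr) (hc : WalkWellDefined c)
    {A : Set (CadlagPath (S → Bool))} (hA : MeasurableSet A) :
    Measurable fun σ => exclusionLaw Pr σ A := by
  have := hPr.isProbabilityMeasure
  obtain ⟨H, hH, heq⟩ := hPr.exists_measurable_path hc
  have : (fun σ => exclusionLaw Pr σ A) = fun σ => Pr (Prod.mk σ ⁻¹' (H ⁻¹' A)) := by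
    funext σ
    rw [hPr.exclusionLaw_eq_map hc heq, Measure.map_apply (measurable_comp_prodMk hH _) hA]
    rfl
  rw [this]
  exact measurable_measure_prodMk_left (hH hA)

/-- The Markov property, integrated over an event `B` of the past. -/
theorem exclusionLaw_inter_shift (hPr : IsPoissonClockLaw c Pr) (hc : WalkWellDefined c)
    (σ : S → Bool) (t : ℝ≥0) {A B : Set (CadlagPath (S → Bool))}
    (hA : MeasurableSet A) (hB : MeasurableSet[canonicalFiltration (S → Bool) t] B) :
    exclusionLaw Pr σ (B ∩ shift t ⁻¹' A) =
      ∫⁻ ζ in B, exclusionLaw Pr (ζ.1 t) A ∂exclusionLaw Pr σ := by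
  have := hPr.isProbabilityMeasure
  obtain ⟨H, hH, heq⟩ := hPr.exists_measurable_path hc
  have hBm := (canonicalFiltration (S → Bool)).le t _ hB
  rw [canonicalFiltration_eq_comap] at hB
  obtain ⟨B, hB, rfl⟩ := hB
  set ρ : CadlagPath (S → Bool) → Set.Iic t → S → Bool := fun ζ s => ζ.1 s with hρ
  have hρm : Measurable ρ := measurable_pi_lambda _ fun s => measurable_eval_path (s : ℝ≥0)
  have htop : t ∈ Set.Iic t := Set.mem_Iic.2 le_rfl
  -- the path up to time `t`, as a function of the clocks up to time `t`
  let V : Clocks S → Set.Iic t → S → Bool := fun K s => configVersion σ K s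
  have hV : Measurable[pastSigma S t] V :=
    @measurable_pi_lambda _ _ _ (_) _ _ fun s => measurable_configVersion_past σ s.2
  have hHσ : Measurable fun K => H (σ, K) := measurable_comp_prodMk hH _
  have hVH : ∀ᵐ K ∂Pr, ρ (H (σ, K)) = V K := by
    filter_upwards [heq, hPr.ae_configPath_apply hc, hPr.ae_configVersion_eq hc] with K h1 h2 h3
    funext s
    simp only [hρ, V, h1, h2, h3]
  have hshift : ∀ᵐ K ∂Pr, shift t (H (σ, K)) = H (V K ⟨t, htop⟩, restart t K) := by
    filter_upwards [heq, hPr.ae_restart heq t, hPr.ae_configPath_apply hc,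
      hPr.ae_restart (hPr.ae_configPath_apply hc) t, hPr.ae_configVersion_eq hc,
      hPr.ae_config_add hc t] with K h1 h1' h2 h2' h3 h4
    refine Subtype.ext (funext fun s => ?_)
    simp only [shift, V, h1, h1', h2, h2', h3, h4]
  have hD : MeasurableSet (((fun p : (Set.Iic t → S → Bool) × Clocks S => p.1) ⁻¹' B) ∩
      (fun p => H (p.1 ⟨t, htop⟩, p.2)) ⁻¹' A) :=
    (measurable_fst hB).inter ((hH.comp (((measurable_pi_apply _).comp measurable_fst).prodMk
      measurable_snd)) hA)
  have hVm : Measurable V := hV.mono (pastSigma_le t) le_rfl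
  have hmapV : (exclusionLaw Pr σ).map ρ = Pr.map V := by
    rw [hPr.exclusionLaw_eq_map hc heq, Measure.map_map hρm hHσ]
    exact Measure.map_congr hVH
  have hint : ∀ v : Set.Iic t → S → Bool, Pr (Prod.mk v ⁻¹'
      (((fun p : (Set.Iic t → S → Bool) × Clocks S => p.1) ⁻¹' B) ∩
        (fun p => H (p.1 ⟨t, htop⟩, p.2)) ⁻¹' A)) =
      B.indicator (fun v => exclusionLaw Pr (v ⟨t, htop⟩) A) v := by
    intro v
    by_cases hv : v ∈ B
    · rw [Set.indicator_of_mem hv, hPr.exclusionLaw_eq_map hc heq,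
        Measure.map_apply (measurable_comp_prodMk hH _) hA]
      congr 1
      ext K
      simp [hv]
    · rw [Set.indicator_of_notMem hv]
      convert measure_empty (μ := Pr)
      ext K
      simp [hv]
  have hmeas : Measurable fun v : Set.Iic t → S → Bool => exclusionLaw Pr (v ⟨t, htop⟩) A :=
    (hPr.measurable_exclusionLaw hc hA).comp (measurable_pi_apply _)
  calc exclusionLaw Pr σ (ρ ⁻¹' B ∩ shift t ⁻¹' A)
      = Pr {K | V K ∈ B ∧ H (V K ⟨t, htop⟩, restart t K) ∈ A} := by
        rw [hPr.exclusionLaw_eq_map hc heq,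
          Measure.map_apply hHσ (hBm.inter (measurable_shift t hA))]
        refine measure_congr ?_
        filter_upwards [hVH, hshift] with K h1 h2
        refine propext ?_
        change ρ (H (σ, K)) ∈ B ∧ shift t (H (σ, K)) ∈ A ↔ _
        rw [h1, h2]
        rfl
    _ = ∫⁻ v in B, exclusionLaw Pr (v ⟨t, htop⟩) A ∂Pr.map V := by
        rw [← lintegral_indicator hB, ← lintegral_congr hint, ← Measure.prod_apply hD,
          ← hPr.map_prodMk_restart hV, Measure.map_apply (hVm.prodMk (measurable_restart t)) hD]
        rfl
    _ = _ := by
        rw [← hmapV, setLIntegral_map hB hmeas hρm]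

theorem isMarkovProcess_exclusionLaw (hPr : IsPoissonClockLaw c Pr) (hc : WalkWellDefined c) :
    IsMarkovProcess (exclusionLaw Pr) where
  isProbabilityMeasure := hPr.isProbabilityMeasure_exclusionLaw hc
  start σ := by
    obtain ⟨H, hH, heq⟩ := hPr.exists_measurable_path hc
    rw [hPr.exclusionLaw_eq_map hc heq, ae_map_iff (measurable_comp_prodMk hH _).aemeasurable
      (measurableSet_eq_fun (measurable_eval_path 0) measurable_const)]
    filter_upwards [heq, hPr.ae_configPath_apply hc, hPr.ae_config_zero hc] with K h1 h2 h3
    rw [h1, h2, h3]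
  measurable _ hA := hPr.measurable_exclusionLaw hc hA
  markov σ t A hA := by
    have := hPr.isProbabilityMeasure_exclusionLaw hc
    have hm := hPr.measurable_exclusionLaw hc hA
    have hmt : Measurable[canonicalFiltration (S → Bool) t]
        fun ζ : CadlagPath (S → Bool) => (exclusionLaw Pr (ζ.1 t)).real A := by
      refine Measurable.ennreal_toReal (hm.comp ?_)
      exact (comap_measurable _).mono
        (le_iSup_of_le (⟨t, Set.mem_Iic.2 le_rfl⟩ : Set.Iic t) le_rfl) le_rfl
    have hle := (canonicalFiltration (S → Bool)).le t
    have hint : Integrable (fun ζ : CadlagPath (S → Bool) => (exclusionLaw Pr (ζ.1 t)).real A)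
        (exclusionLaw Pr σ) := by
      refine Integrable.of_bound (hmt.mono hle le_rfl).aestronglyMeasurable 1
        (Eventually.of_forall fun ζ => ?_)
      rw [Real.norm_of_nonneg measureReal_nonneg]
      exact measureReal_le_one
    refine (ae_eq_condExp_of_forall_setIntegral_eq hle ?_ (fun B _ _ => hint.integrableOn)
      (fun B hB _ => ?_) hmt.stronglyMeasurable.aestronglyMeasurable).symm
    · exact (integrable_const (1 : ℝ)).indicator (measurable_shift t hA)
    · rw [setIntegral_indicator (measurable_shift t hA), setIntegral_const, smul_eq_mul, mul_one]
      simp only [Measure.real]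
      rw [integral_toReal (f := fun ζ : CadlagPath (S → Bool) => exclusionLaw Pr (ζ.1 t) A)
        (hm.comp (measurable_eval_path t)).aemeasurable
        (Eventually.of_forall fun ζ => measure_lt_top _ _),
        hPr.exclusionLaw_inter_shift hc σ t hA hB]

end IsPoissonClockLaw
end Law

/-! ### The Feller property and the transition semigroup -/

/-- A continuous function on `{0,1}^S` depends up to `ε` on finitely many coordinates. -/
theorem exists_finset_dist_lt {S : Type*} (f : C(S → Bool, ℝ)) {ε : ℝ} (hε : 0 < ε) :
    ∃ F : Finset S, ∀ σ τ : S → Bool, (∀ x ∈ F, σ x = τ x) → dist (f σ) (f τ) < ε := by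
  have h := CompactSpace.uniformContinuous_of_continuous f.continuous
    (Metric.dist_mem_uniformity hε)
  rw [Filter.mem_map, Pi.uniformity, Filter.mem_iInf] at h
  obtain ⟨I, hI, V, hV, heq⟩ := h
  refine ⟨hI.toFinset, fun σ τ hστ => ?_⟩
  have hmem : (σ, τ) ∈ ⋂ i, V i := by
    refine Set.mem_iInter.2 fun i => ?_
    obtain ⟨W, hW, hWV⟩ := Filter.mem_comap.1 (hV i)
    refine hWV ?_
    change (σ i, τ i) ∈ W
    rw [hστ i (hI.mem_toFinset.2 i.2)]
    exact refl_mem_uniformity hW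
  rw [← heq] at hmem
  exact hmem

section Semigroup

variable {S : Type*} [Countable S] {c : Edge S → ℝ≥0} {Pr : Measure (Clocks S)}

namespace IsPoissonClockLaw

theorem integrable_configVersion (hPr : IsPoissonClockLaw c Pr) (f : C(S → Bool, ℝ)) (t : ℝ≥0)
    (σ : S → Bool) : Integrable (fun K => f (configVersion σ K t)) Pr := by
  have := hPr.isProbabilityMeasure
  refine Integrable.of_bound (f.continuous.measurable.comp
    (measurable_comp_prodMk (measurable_configVersion t) σ)).aestronglyMeasurable ‖f‖
    (Eventually.of_forall fun K => f.norm_coe_le_norm _)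

theorem measure_not_quiet_le (hPr : IsPoissonClockLaw c Pr) {x : S} (hx : exitRate c x ≠ ∞)
    (t : ℝ≥0) :
    Pr.real {K | ¬ Quiet K (star x) 0 t} ≤ 1 - Real.exp (-(totalRate c x * t)) := by
  have := hPr.isProbabilityMeasure
  have h1 := hPr.le_measure_quiet (fun F hF => sum_le_totalRate hx hF) t
  have h2 := (ENNReal.ofReal_le_iff_le_toReal (measure_ne_top _ _)).1 h1
  have h3 := probReal_compl_eq_one_sub (μ := Pr) (measurableSet_quiet (star x) 0 t)
  rw [show {K : Clocks S | ¬ Quiet K (star x) 0 t} = {K | Quiet K (star x) 0 t}ᶜ from rfl, h3]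
  exact sub_le_sub_left h2 _

variable [MeasurableSpace S] [DiscreteMeasurableSpace S]

theorem integral_config_eq (hPr : IsPoissonClockLaw c Pr) (hc : WalkWellDefined c)
    (f : C(S → Bool, ℝ)) (t : ℝ≥0) (σ : S → Bool) :
    ∫ K in gammaStar S, f (config σ K t) ∂Pr = ∫ K, f (configVersion σ K t) ∂Pr := by
  rw [hPr.restrict_gammaStar hc]
  refine integral_congr_ae ?_
  filter_upwards [hPr.ae_configVersion_eq hc] with K hK
  rw [hK]

theorem continuous_integral_config (hPr : IsPoissonClockLaw c Pr) (hc : WalkWellDefined c)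
    (f : C(S → Bool, ℝ)) (t : ℝ≥0) :
    Continuous fun σ : S → Bool => ∫ K in gammaStar S, f (config σ K t) ∂Pr := by
  have := hPr.isProbabilityMeasure
  simp only [hPr.integral_config_eq hc]
  refine continuous_of_dominated (bound := fun _ => ‖f‖)
    (fun σ => (hPr.integrable_configVersion f t σ).aestronglyMeasurable)
    (fun σ => Eventually.of_forall fun K => f.norm_coe_le_norm _) (integrable_const _) ?_
  filter_upwards [hPr.ae_configVersion_eq hc] with K hK
  simp only [hK]
  exact f.continuous.comp (continuous_config K t)

theorem integral_config_eq_integral_exclusionLaw (hPr : IsPoissonClockLaw c Pr)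
    (hc : WalkWellDefined c) (f : C(S → Bool, ℝ)) (t : ℝ≥0) (σ : S → Bool) :
    ∫ K in gammaStar S, f (config σ K t) ∂Pr = ∫ η, f (η.1 t) ∂exclusionLaw Pr σ := by
  have hm : Measurable fun η : CadlagPath (S → Bool) => f (η.1 t) :=
    f.continuous.measurable.comp (measurable_eval_path t)
  rw [exclusionLaw, hPr.restrict_gammaStar hc, integral_map (hPr.aemeasurable_configPath hc σ)
    hm.aestronglyMeasurable]
  refine integral_congr_ae ?_
  filter_upwards [hPr.ae_configPath_apply hc] with K hK
  rw [hK]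

theorem isFellerProcess_exclusionLaw (hPr : IsPoissonClockLaw c Pr) (hc : WalkWellDefined c) :
    IsFellerProcess (exclusionLaw Pr) where
  toIsMarkovProcess := hPr.isMarkovProcess_exclusionLaw hc
  feller f t := by
    simp only [← hPr.integral_config_eq_integral_exclusionLaw hc]
    exact hPr.continuous_integral_config hc f t

/-- The transition operator `(S(t) f)(σ) = E f(η_t^σ)`. -/
noncomputable def transition (hPr : IsPoissonClockLaw c Pr) (hc : WalkWellDefined c) (t : ℝ≥0) :
    C(S → Bool, ℝ) →L[ℝ] C(S → Bool, ℝ) :=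
  LinearMap.mkContinuous
    { toFun := fun f => ⟨fun σ => ∫ K in gammaStar S, f (config σ K t) ∂Pr,
        hPr.continuous_integral_config hc f t⟩
      map_add' := fun f g => by
        ext σ
        have h := hPr.integral_config_eq hc (f + g) t σ
        have hf := hPr.integral_config_eq hc f t σ
        have hg := hPr.integral_config_eq hc g t σ
        simp only [ContinuousMap.coe_mk, ContinuousMap.add_apply] at h ⊢
        rw [h, hf, hg]
        exact integral_add (hPr.integrable_configVersion f t σ)
          (hPr.integrable_configVersion g t σ)
      map_smul' := fun a f => by
        ext σ
        exact integral_const_mul a _ }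
    1 fun f => by
      have := hPr.isProbabilityMeasure
      rw [one_mul]
      refine (ContinuousMap.norm_le _ (norm_nonneg _)).2 fun σ => ?_
      change ‖∫ K in gammaStar S, f (config σ K t) ∂Pr‖ ≤ ‖f‖
      rw [hPr.restrict_gammaStar hc]
      refine (norm_integral_le_of_norm_le_const
        (Eventually.of_forall fun K => f.norm_coe_le_norm _)).trans ?_
      simp

theorem transition_apply (hPr : IsPoissonClockLaw c Pr) (hc : WalkWellDefined c) (t : ℝ≥0)
    (f : C(S → Bool, ℝ)) (σ : S → Bool) :
    hPr.transition hc t f σ = ∫ K in gammaStar S, f (config σ K t) ∂Pr := rfl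

theorem transition_zero (hPr : IsPoissonClockLaw c Pr) (hc : WalkWellDefined c) :
    hPr.transition hc 0 = ContinuousLinearMap.id ℝ _ := by
  have := hPr.isProbabilityMeasure
  ext f σ
  rw [transition_apply, hPr.restrict_gammaStar hc]
  have : ∫ K, f (config σ K 0) ∂Pr = ∫ _K : Clocks S, f σ ∂Pr := by
    refine integral_congr_ae ?_
    filter_upwards [hPr.ae_config_zero hc] with K hK
    rw [hK]
  rw [this]
  simp

theorem transition_add (hPr : IsPoissonClockLaw c Pr) (hc : WalkWellDefined c) (s t : ℝ≥0) :
    hPr.transition hc (s + t) = (hPr.transition hc s).comp (hPr.transition hc t) := by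
  have := hPr.isProbabilityMeasure
  ext f σ
  have hV := measurable_configVersion_past σ (le_refl s)
  have hVm := hV.mono (pastSigma_le s) le_rfl
  have hF : Measurable fun p : (S → Bool) × Clocks S => f (configVersion p.1 p.2 t) :=
    f.continuous.measurable.comp (measurable_configVersion t)
  rw [ContinuousLinearMap.comp_apply, transition_apply, hPr.integral_config_eq hc,
    hPr.transition_apply hc s, hPr.integral_config_eq hc]
  calc ∫ K, f (configVersion σ K (s + t)) ∂Pr
      = ∫ K, f (configVersion (configVersion σ K s) (restart s K) t) ∂Pr := by
        refine integral_congr_ae ?_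
        have h := hPr.ae_configVersion_eq hc
        filter_upwards [h, hPr.ae_restart h s, hPr.ae_config_add hc s] with K h1 h2 h3
        rw [h1, h1, h2, h3]
    _ = ∫ p, f (configVersion p.1 p.2 t) ∂(Pr.map fun K => configVersion σ K s).prod Pr := by
        rw [← hPr.map_prodMk_restart hV,
          integral_map (hVm.prodMk (measurable_restart s)).aemeasurable hF.aestronglyMeasurable]
    _ = ∫ τ, ∫ K, f (configVersion τ K t) ∂Pr ∂Pr.map fun K => configVersion σ K s := by
        have := Measure.isProbabilityMeasure_map (μ := Pr) hVm.aemeasurable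
        exact integral_prod _ (Integrable.of_bound hF.aestronglyMeasurable ‖f‖
          (Eventually.of_forall fun p => f.norm_coe_le_norm _))
    _ = ∫ K, hPr.transition hc t f (configVersion σ K s) ∂Pr := by
        refine Eq.trans ?_ (integral_map hVm.aemeasurable
          (hPr.transition hc t f).continuous.measurable.aestronglyMeasurable)
        simp only [transition_apply, hPr.integral_config_eq hc]

/-- A configuration changes little in short time: the values of `η_t^σ` at finitely many sites are
the initial ones unless one of the clocks at these sites rings. -/
theorem abs_transition_sub_le (hPr : IsPoissonClockLaw c Pr) (hc : WalkWellDefined c)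
    (f : C(S → Bool, ℝ)) {ε : ℝ} {F : Finset S}
    (hF : ∀ σ τ : S → Bool, (∀ x ∈ F, σ x = τ x) → dist (f σ) (f τ) ≤ ε) (t : ℝ≥0)
    (σ : S → Bool) :
    |hPr.transition hc t f σ - f σ| ≤
      ε + 2 * ‖f‖ * ∑ x ∈ F, (1 - Real.exp (-(totalRate c x * t))) := by
  have := hPr.isProbabilityMeasure
  have hε : 0 ≤ ε := dist_nonneg.trans (hF σ σ fun _ _ => rfl)
  let E : Set (Clocks S) := ⋃ x ∈ F, {K | ¬ Quiet K (star x) 0 t}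
  have hE : MeasurableSet E :=
    F.measurableSet_biUnion fun x _ => (measurableSet_quiet (star x) 0 t).compl
  have hEle : Pr.real E ≤ ∑ x ∈ F, (1 - Real.exp (-(totalRate c x * t))) :=
    (measureReal_biUnion_finset_le _ _).trans (Finset.sum_le_sum fun x _ =>
      hPr.measure_not_quiet_le (hc.exitRate_ne_top x) t)
  have hint := hPr.integrable_configVersion f t σ
  have hb' : Integrable (E.indicator (1 : Clocks S → ℝ)) Pr :=
    (integrable_const (1 : ℝ)).indicator hE
  have hb : Integrable (fun K => ε + 2 * ‖f‖ * E.indicator 1 K) Pr :=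
    (integrable_const _).add (hb'.const_mul _)
  have hpt : ∀ᵐ K ∂Pr, ‖f (configVersion σ K t) - f σ‖ ≤ ε + 2 * ‖f‖ * E.indicator 1 K := by
    filter_upwards [hPr.ae_mem_gammaStar hc, hPr.ae_configVersion_eq hc] with K h1 h2
    by_cases hK : K ∈ E
    · rw [Set.indicator_of_mem hK, Pi.one_apply, mul_one]
      have a1 := norm_sub_le (f (configVersion σ K t)) (f σ)
      have a2 := f.norm_coe_le_norm (configVersion σ K t)
      have a3 := f.norm_coe_le_norm σ
      linarith
    · rw [Set.indicator_of_notMem hK, mul_zero, add_zero, ← dist_eq_norm, h2]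
      refine hF _ _ fun x hx => ?_
      have hq : Quiet K (star x) 0 t := by
        by_contra hq
        exact hK (Set.mem_biUnion hx hq)
      have : stir K t x = some x := (stir_eq_some_iff_reach h1.1).2 ⟨0, rfl, hq⟩
      simp [config, this]
  calc |hPr.transition hc t f σ - f σ|
      = ‖∫ K, (f (configVersion σ K t) - f σ) ∂Pr‖ := by
        rw [integral_sub hint (integrable_const _), transition_apply, hPr.integral_config_eq hc]
        simp
    _ ≤ ∫ K, (ε + 2 * ‖f‖ * E.indicator 1 K) ∂Pr := norm_integral_le_of_norm_le hb hpt
    _ = ε + 2 * ‖f‖ * Pr.real E := by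
        rw [integral_add (integrable_const _) (hb'.const_mul _), integral_const_mul,
          integral_indicator_one hE]
        simp
    _ ≤ _ := by gcongr

theorem tendsto_transition (hPr : IsPoissonClockLaw c Pr) (hc : WalkWellDefined c)
    (f : C(S → Bool, ℝ)) : Tendsto (fun t => hPr.transition hc t f) (𝓝[>] 0) (𝓝 f) := by
  refine Metric.tendsto_nhds.2 fun ε hε => ?_
  obtain ⟨F, hF⟩ := exists_finset_dist_lt f (half_pos hε)
  have hlim : Tendsto (fun t : ℝ≥0 =>
      ε / 2 + 2 * ‖f‖ * ∑ x ∈ F, (1 - Real.exp (-(totalRate c x * t)))) (𝓝[>] 0) (𝓝 (ε / 2)) := by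
    have : Continuous fun t : ℝ≥0 =>
        ε / 2 + 2 * ‖f‖ * ∑ x ∈ F, (1 - Real.exp (-(totalRate c x * t))) := by fun_prop
    simpa using (this.tendsto 0).mono_left nhdsWithin_le_nhds
  filter_upwards [hlim.eventually (gt_mem_nhds (half_lt_self hε))] with t ht
  refine lt_of_le_of_lt ((ContinuousMap.dist_le ?_).2 fun σ => ?_) ht
  · exact (abs_nonneg _).trans
      (hPr.abs_transition_sub_le hc f (fun σ τ h => (hF σ τ h).le) t fun _ => false)
  · exact hPr.abs_transition_sub_le hc f (fun σ τ h => (hF σ τ h).le) t σ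

theorem isStronglyContinuousSemigroup_transition (hPr : IsPoissonClockLaw c Pr)
    (hc : WalkWellDefined c) : IsStronglyContinuousSemigroup (hPr.transition hc) where
  zero := hPr.transition_zero hc
  add := hPr.transition_add hc
  strong := hPr.tendsto_transition hc

end IsPoissonClockLaw
end Semigroup

end SSEP

theorem proposition3p2 {S : Type*} [Countable S] [Infinite S] [MeasurableSpace S]
    [DiscreteMeasurableSpace S] (c : SSEP.Edge S → ℝ≥0) (hc : SSEP.WalkWellDefined c)
    (Pr : Measure (SSEP.Clocks S)) (hPr : SSEP.IsPoissonClockLaw c Pr) :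
    (∀ (f : C(S → Bool, ℝ)) (t : ℝ≥0),
      Continuous fun σ : S → Bool => ∫ K in SSEP.gammaStar S, f (SSEP.config σ K t) ∂Pr) ∧
    (∀ (f : C(S → Bool, ℝ)) (t : ℝ≥0) (σ : S → Bool),
      ∫ K in SSEP.gammaStar S, f (SSEP.config σ K t) ∂Pr =
        ∫ η, f (η.1 t) ∂SSEP.exclusionLaw Pr σ) ∧
    SSEP.IsFellerProcess (SSEP.exclusionLaw Pr) ∧
    ∃ T : ℝ≥0 → C(S → Bool, ℝ) →L[ℝ] C(S → Bool, ℝ),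
      (∀ (t : ℝ≥0) (f : C(S → Bool, ℝ)) (σ : S → Bool),
        T t f σ = ∫ K in SSEP.gammaStar S, f (SSEP.config σ K t) ∂Pr) ∧
      SSEP.IsStronglyContinuousSemigroup T :=
  ⟨hPr.continuous_integral_config hc, hPr.integral_config_eq_integral_exclusionLaw hc,
    hPr.isFellerProcess_exclusionLaw hc, hPr.transition hc, hPr.transition_apply hc,
    hPr.isStronglyContinuousSemigroup_transition hc⟩
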